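/- Let $\Omega$ be a finite set of states with a prior $\mu\in\Delta(\Omega)$, let $A$ be a finite nonempty set of actions, let $u_S,u_R:\Omega\times A\to\mathbb R$ be the payoff functions of a sender $S$ and a receiver $R$, and let $Q:X\to\Delta(Y)$ be a channel with finite nonempty input set $X$ and finite output set $Y$. All logarithms are in base $2$, and $0\log 0=0$. **The game.** For integers $n\ge 1$ and $k\ge 0$ let $\mu^n(\omega^n)=\prod_{t=1}^n\mu(\omega_t)$, $Q^k(y^k|x^k)=\prod_{t=1}^kQ(y_t|x_t)$ and $\bar u_i(\omega^n,a^n)=\frac1n\sum_{t=1}^nu_i(\omega_t,a_t)$. A strategy of the sender is a map $\sigma:\Omega^n\to\Delta(X^k)$. The set $BR(\sigma)$ of best replies consists of the maps $\tau:Y^k\to A^n$ such that for every $y^k$ $$\tau(y^k)\in\operatorname*{argmax}_{a^n\in A^n}\sum_{\omega^n,x^k}\mu^n(\omega^n)\sigma(x^k|\omega^n)Q^k(y^k|x^k)\bar u_R(\omega^n,a^n).$$ The optimal robust payoff of the sender is $$U^*_S(\mu^n,Q^k)=\sup_\sigma\min_{\tau\in BR(\sigma)}\sum_{\omega^n,x^k,y^k}\mu^n(\omega^n)\sigma(x^k|\omega^n)Q^k(y^k|x^k)\,\bar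 u_S(\omega^n,\tau(y^k)).$$ **The splitting problem.** For $\nu\in\Delta(\Omega)$ let $A^*(\nu)=\operatorname{argmax}_{a\in A}\sum_\omega\nu(\omega)u_R(\omega,a)$ and $u^*_S(\nu)=\min_{a\in A^*(\nu)}\sum_\omega\nu(\omega)u_S(\omega,a)$. Let $H(q)=-\sum_sq(s)\log q(s)$ be the entropy, and let $$C(Q)=\max_{p\in\Delta(X)}\Big[H\Big(\sum_xp(x)Q(\cdot|x)\Big)-\sum_xp(x)H(Q(\cdot|x))\Big]$$ be the capacity of the channel. For $c\in[0,+\infty]$ let $$V(\mu,c)=\sup\Big\{\sum_m\lambda_mu^*_S(\nu_m)\;:\;\sum_m\lambda_m\nu_m=\mu,\ H(\mu)-\sum_m\lambda_mH(\nu_m)\le c\Big\},$$ where the supremum is over finite families $(\lambda_m,\nu_m)_m$ with $\nu_m\in\Delta(\Omega)$, $\lambda_m\ge0$, $\sum_m\lambda_m=1$. **Theorem.** 1. For all integers $n\ge1$ and $k\ge0$, $\;U^*_S(\mu^n,Q^k)\le V\big(\mu,\tfrac knC(Q)\big)$. 2. Let $r\in[0,+\infty]$ and let $(n_j)_j,(k_j)_j$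 be sequences of integers with $n_j\ge1$, $k_j\ge0$, $\max(n_j,k_j)\to\infty$ and $k_j/n_j\to r$. If $r=0$ and $C(Q)>0$, assume in addition that $u^*_S$, restricted to the beliefs $\nu\in\Delta(\Omega)$ whose support is contained in that of $\mu$, is continuous at $\mu$. Then $$\lim_{j\to\infty}U^*_S(\mu^{n_j},Q^{k_j})=V\big(\mu,rC(Q)\big),\qquad\text{with the convention }(+\infty)\cdot0=0.$$ -/

import Mathlib

/-!
Finite probability distributions are elements of `stdSimplex ℝ S`; a transition probability from
`S` to `T` is a map `P : S → T → ℝ` with `P s ∈ stdSimplex ℝ T` for every `s`.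
-/

namespace Persuasion

noncomputable section

/-- Shannon entropy in bits (with `0 log 0 = 0`). -/
def entropy {S : Type*} [Fintype S] (q : S → ℝ) : ℝ :=
  -∑ s, q s * Real.logb 2 (q s)

/-- Mutual information between input and output of the channel `Q` when the input has law `p`. -/
def mutualInfo {X Y : Type*} [Fintype X] [Fintype Y] (p : X → ℝ) (Q : X → Y → ℝ) : ℝ :=
  entropy (fun y => ∑ x, p x * Q x y) - ∑ x, p x * entropy (Q x)

/-- Channel capacity: the maximum of the mutual information over all input distributions. -/
def capacity {X Y : Type*} [Fintype X] [Fintype Y] (Q : X → Y → ℝ) : ℝ :=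
  sSup ((fun p => mutualInfo p Q) '' stdSimplex ℝ X)

/-- Expected value of `u (·, a)` at the belief `ν`. -/
def expPayoff {Ω A : Type*} [Fintype Ω] (u : Ω → A → ℝ) (ν : Ω → ℝ) (a : A) : ℝ :=
  ∑ ω, ν ω * u ω a

/-- The receiver's optimal actions at the belief `ν`. -/
def optActions {Ω A : Type*} [Fintype Ω] (uR : Ω → A → ℝ) (ν : Ω → ℝ) : Set A :=
  {a | ∀ b, expPayoff uR ν b ≤ expPayoff uR ν a}

/-- The sender's robust payoff at the belief `ν`: the minimum over the receiver's optimal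
actions (a nonempty finite set when `A` is finite and nonempty). -/
def robustPayoff {Ω A : Type*} [Fintype Ω] (uS uR : Ω → A → ℝ) (ν : Ω → ℝ) : ℝ :=
  sInf (expPayoff uS ν '' optActions uR ν)

/-- `(lam m, ν m)`, `m : Fin M`, is a splitting of `μ`. -/
structure IsSplitting {Ω : Type*} [Fintype Ω] (μ : Ω → ℝ) {M : ℕ}
    (lam : Fin M → ℝ) (ν : Fin M → Ω → ℝ) : Prop where
  weights : lam ∈ stdSimplex ℝ (Fin M)
  posteriors : ∀ m, ν m ∈ stdSimplex ℝ Ω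
  average : ∀ ω, ∑ m, lam m * ν m ω = μ ω

/-- Expected reduction of entropy of a splitting, i.e. the mutual information between the state
and the message. -/
def splittingInfo {Ω : Type*} [Fintype Ω] (μ : Ω → ℝ) {M : ℕ}
    (lam : Fin M → ℝ) (ν : Fin M → Ω → ℝ) : ℝ :=
  entropy μ - ∑ m, lam m * entropy (ν m)

/-- Value of the optimal splitting problem with information constraint `c`, where `c = ⊤` means
that there is no constraint. -/
def splittingValue {Ω A : Type*} [Fintype Ω] (uS uR : Ω → A → ℝ) (μ : Ω → ℝ) (c : EReal) : ℝ :=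
  sSup {v | ∃ (M : ℕ) (lam : Fin M → ℝ) (ν : Fin M → Ω → ℝ),
    IsSplitting μ lam ν ∧ ((splittingInfo μ lam ν : ℝ) : EReal) ≤ c ∧
    v = ∑ m, lam m * robustPayoff uS uR (ν m)}

/-- Product law of `n` i.i.d. states. -/
def iidLaw {Ω : Type*} (μ : Ω → ℝ) {n : ℕ} (ω : Fin n → Ω) : ℝ :=
  ∏ t, μ (ω t)

/-- `k` independent uses of the channel `Q`. -/
def channelPow {X Y : Type*} (Q : X → Y → ℝ) {k : ℕ} (x : Fin k → X) (y : Fin k → Y) : ℝ :=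
  ∏ t, Q (x t) (y t)

/-- Average payoff over the `n` problems. -/
def avgPayoff {Ω A : Type*} (u : Ω → A → ℝ) {n : ℕ} (ω : Fin n → Ω) (a : Fin n → A) : ℝ :=
  (1 / (n : ℝ)) * ∑ t, u (ω t) (a t)

/-- Strategies of the sender: transition probabilities from `Ω ^ n` to `X ^ k`. -/
def senderStrategies (Ω X : Type*) [Fintype X] (n k : ℕ) :
    Set ((Fin n → Ω) → (Fin k → X) → ℝ) :=
  {σ | ∀ ω, σ ω ∈ stdSimplex ℝ (Fin k → X)}

/-- Best replies of the receiver to the sender's strategy `σ`: for every output sequence `y`,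
the action sequence `τ y` maximizes the expected average payoff given `y` (unnormalized). -/
def bestReplies {Ω A X Y : Type*} [Fintype Ω] [Fintype X]
    (uR : Ω → A → ℝ) (μ : Ω → ℝ) (Q : X → Y → ℝ) {n k : ℕ}
    (σ : (Fin n → Ω) → (Fin k → X) → ℝ) : Set ((Fin k → Y) → (Fin n → A)) :=
  {τ | ∀ y, ∀ a : Fin n → A,
    ∑ ω, ∑ x, iidLaw μ ω * σ ω x * channelPow Q x y * avgPayoff uR ω a ≤
      ∑ ω, ∑ x, iidLaw μ ω * σ ω x * channelPow Q x y * avgPayoff uR ω (τ y)}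

/-- Expected average payoff of the sender under the strategies `σ` and `τ`. -/
def senderPayoff {Ω A X Y : Type*} [Fintype Ω] [Fintype X] [Fintype Y]
    (uS : Ω → A → ℝ) (μ : Ω → ℝ) (Q : X → Y → ℝ) {n k : ℕ}
    (σ : (Fin n → Ω) → (Fin k → X) → ℝ) (τ : (Fin k → Y) → (Fin n → A)) : ℝ :=
  ∑ ω, ∑ x, ∑ y, iidLaw μ ω * σ ω x * channelPow Q x y * avgPayoff uS ω (τ y)

/-- Optimal robust payoff of the sender with `n` problems and `k` uses of the channel: the
supremum over the sender's strategies of the minimum over the receiver's best replies. -/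
def optimalRobustPayoff {Ω A X Y : Type*} [Fintype Ω] [Fintype X] [Fintype Y]
    (uS uR : Ω → A → ℝ) (μ : Ω → ℝ) (Q : X → Y → ℝ) (n k : ℕ) : ℝ :=
  sSup ((fun σ => sInf (senderPayoff uS μ Q σ '' bestReplies uR μ Q σ)) ''
    senderStrategies Ω X n k)

end

end Persuasion

namespace Persuasion

open Finset Real Filter Topology

noncomputable section

/-! Upper bound. Given an output `y`, the receiver's problem separates over the `n` coordinates, so
a strategy is worth the average of the robust payoff over the posterior marginals
(`sInf_senderPayoff_eq`). The pairs `(y, t)` with `t` uniform form a splitting of `μ`. Subadditivity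
of entropy and the data processing inequality bound its information by `k/n` times the capacity
(`robustValue_le_splittingValue`).

Lower bound. A nearly optimal splitting is mixed with the prior, which makes its information
strictly slack and gives every posterior the support of `μ` (`exists_full_support_splitting`). A
lossy source code of rate just above that information (`exists_source_code`) is sent through a
channel code (`exists_channel_code`). The actual posteriors `q` must then be compared with the
targets `ν`. Taking the worst optimal action makes the robust payoff lower semicontinuous, hence at
least its value at `ν`, minus `ε`, minus `K` times the divergence of `q` from `ν`
(`exists_sub_mul_divergence_le`). The divergence is a cross entropy, linear in `q`, minus the
entropy of `q`. The linear part joins the payoff in a score that is additive over coordinates, and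
the covering code makes this score large. The entropy part is controlled because an index with `L`
values removes at most `log L` from the entropy of the states. At a rate close to the mutual
information the two parts nearly cancel, so the average divergence is small (`encoder_payoff_le`,
`exists_forall_le_optimalRobustPayoff`).

Limits. For `0 < r < ∞`, scaling the constraint gives right continuity of the value
(`splittingValue_mul_le`). For `r = 0`, continuity at the prior gives a linear bound on the value
near zero information. For `r = ∞`, `n` may stay bounded, and each fixed `n` is handled by
simulating the splitting exactly over a good channel code.

Entropy and robust payoff are positively homogeneous, so joint laws are used throughout in place of
conditional laws. -/

/-- Entropy in nats of a finite measure, extended to be positively homogeneous. -/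
def hEnt {S : Type*} [Fintype S] (q : S → ℝ) : ℝ :=
  ∑ s, q s * (log (∑ s, q s) - log (q s))

/-- Cross entropy in nats. -/
def crossEnt {S : Type*} [Fintype S] (q r : S → ℝ) : ℝ :=
  -∑ s, q s * log (r s)

/-- The `t`-th marginal of a measure on a power. -/
def marginal {S : Type*} [Fintype S] {n : ℕ} (q : (Fin n → S) → ℝ) (t : Fin n) (s : S) : ℝ :=
  open Classical in ∑ x, if x t = s then q x else 0

/-! ### Entropy, Gibbs' inequality and divergence -/

section Entropy

variable {S T ι : Type*} [Fintype S] [Fintype T] [Fintype ι]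

theorem entropy_eq_hEnt {q : S → ℝ} (hq : ∑ s, q s = 1) : entropy q = hEnt q / log 2 := by
  simp only [entropy, hEnt, hq, log_one, zero_sub, mul_neg, sum_neg_distrib, logb, neg_div,
    sum_div, mul_div_assoc]

theorem crossEnt_sub_hEnt_eq {q r : S → ℝ} :
    crossEnt q r - hEnt q = -∑ s, q s * (log (∑ s, q s) - log (q s) + log (r s)) := by
  simp only [crossEnt, hEnt, mul_add, sum_add_distrib]; ring

/-- Gibbs' inequality. -/
theorem hEnt_le_crossEnt {q r : S → ℝ} (hq : ∀ s, 0 ≤ q s) (hr : ∀ s, 0 ≤ r s)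
    (hqr : ∀ s, q s ≠ 0 → r s ≠ 0) (hr1 : ∑ s, r s ≤ 1) : hEnt q ≤ crossEnt q r := by
  have h0 : 0 ≤ ∑ s, q s := sum_nonneg fun s _ => hq s
  have key : ∀ s, q s * (log (∑ s, q s) - log (q s) + log (r s)) ≤ (∑ s, q s) * r s - q s := by
    intro s
    by_cases h : q s = 0
    · simpa [h] using mul_nonneg h0 (hr s)
    have h1 : 0 < q s := lt_of_le_of_ne (hq s) (Ne.symm h)
    have h2 : 0 < r s := lt_of_le_of_ne (hr s) (Ne.symm (hqr s h))
    have h3 : 0 < ∑ s, q s := lt_of_lt_of_le h1 (single_le_sum (fun i _ => hq i) (mem_univ s))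
    have : log (∑ s, q s) - log (q s) + log (r s) = log ((∑ s, q s) * r s / q s) := by
      rw [log_div (by positivity) h, log_mul h3.ne' h2.ne']; ring
    rw [this]
    calc q s * log ((∑ s, q s) * r s / q s) ≤ q s * ((∑ s, q s) * r s / q s - 1) := by
          gcongr; exact log_le_sub_one_of_pos (by positivity)
      _ = _ := by field_simp
  have := sum_le_sum fun s (_ : s ∈ univ) => key s
  rw [sum_sub_distrib, ← mul_sum] at this
  have h4 : (∑ s, q s) * ∑ s, r s ≤ (∑ s, q s) * 1 := by gcongr
  have := crossEnt_sub_hEnt_eq (q := q) (r := r)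
  linarith

theorem hEnt_smul {q : S → ℝ} (hq : ∀ s, 0 ≤ q s) (c : ℝ) :
    hEnt (fun s => c * q s) = c * hEnt q := by
  by_cases hc : c = 0
  · simp [hc, hEnt]
  unfold hEnt
  rw [mul_sum]
  refine sum_congr rfl fun s _ => ?_
  rw [← mul_sum]
  by_cases h : q s = 0
  · simp [h]
  have h' : ∑ s, q s ≠ 0 := ((lt_of_le_of_ne (hq s) (Ne.symm h)).trans_le
    (single_le_sum (fun i _ => hq i) (mem_univ s))).ne'
  rw [log_mul hc h, log_mul hc h']; ring

/-- Concavity of entropy in homogeneous form. Gibbs' inequality compares each `q i` with the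
normalized sum, and these cross entropies add up exactly to the entropy of the sum. -/
theorem sum_hEnt_le (q : ι → S → ℝ) (hq : ∀ i s, 0 ≤ q i s) :
    ∑ i, hEnt (q i) ≤ hEnt (fun s => ∑ i, q i s) := by
  set Z := ∑ s, ∑ i, q i s with hZ
  have hZ0 : 0 ≤ Z := sum_nonneg fun s _ => sum_nonneg fun i _ => hq i s
  have hle : ∀ i s, q i s ≤ ∑ i, q i s := fun i s => single_le_sum (fun i _ => hq i s) (mem_univ i)
  have hpos : ∀ i s, q i s ≠ 0 → 0 < ∑ i, q i s := fun i s h =>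
    (lt_of_le_of_ne (hq i s) (Ne.symm h)).trans_le (hle i s)
  have hZpos : ∀ s, 0 < ∑ i, q i s → 0 < Z := fun s h => h.trans_le
    (single_le_sum (f := fun s => ∑ i, q i s) (fun s _ => sum_nonneg fun i _ => hq i s) (mem_univ s))
  have h1 : ∀ i, hEnt (q i) ≤ crossEnt (q i) (fun s => (∑ i, q i s) / Z) := by
    intro i
    refine hEnt_le_crossEnt (hq i) (fun s => div_nonneg (sum_nonneg fun i _ => hq i s) hZ0) ?_ ?_
    · intro s hs
      exact (div_pos (hpos i s hs) (hZpos s (hpos i s hs))).ne'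
    · rw [← sum_div]; exact div_self_le_one Z
  refine (sum_le_sum fun i _ => h1 i).trans (le_of_eq ?_)
  simp only [crossEnt, hEnt, ← hZ, sum_mul, ← sum_neg_distrib]
  rw [sum_comm]
  refine sum_congr rfl fun s _ => sum_congr rfl fun i _ => ?_
  by_cases h : q i s = 0
  · simp [h]
  rw [log_div (hpos i s h).ne' (hZpos s (hpos i s h)).ne']; ring

theorem hEnt_nonneg {q : S → ℝ} (hq : ∀ s, 0 ≤ q s) : 0 ≤ hEnt q := by
  refine sum_nonneg fun s _ => ?_
  by_cases h : q s = 0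
  · simp [h]
  have h1 : 0 < q s := lt_of_le_of_ne (hq s) (Ne.symm h)
  exact mul_nonneg h1.le (sub_nonneg.2 (log_le_log h1 (single_le_sum (fun i _ => hq i) (mem_univ s))))

theorem hEnt_le_log_card {q : S → ℝ} (hq : q ∈ stdSimplex ℝ S) :
    hEnt q ≤ log (Fintype.card S) := by
  have hne : (Fintype.card S : ℝ) ≠ 0 := by
    intro h
    have : IsEmpty S := Fintype.card_eq_zero_iff.1 (by exact_mod_cast h)
    have := hq.2
    simp at this
  refine (hEnt_le_crossEnt (r := fun _ => (Fintype.card S : ℝ)⁻¹) hq.1 (fun _ => by positivity)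
    (fun _ _ => inv_ne_zero hne) ?_).trans ?_
  · simp [hne]
  · simp [crossEnt, ← sum_mul, hq.2]

theorem hEnt_add_sum_hEnt (J : S → T → ℝ) :
    hEnt (fun s => ∑ t, J s t) + ∑ s, hEnt (J s) =
      (∑ s, ∑ t, J s t) * log (∑ s, ∑ t, J s t) - ∑ s, ∑ t, J s t * log (J s t) := by
  simp only [hEnt, mul_sub, sum_sub_distrib, ← sum_mul]; ring

/-- Chain rule for the entropy of a joint law, in both orders. -/
theorem hEnt_chain (J : S → T → ℝ) :
    hEnt (fun s => ∑ t, J s t) + ∑ s, hEnt (J s) =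
      hEnt (fun t => ∑ s, J s t) + ∑ t, hEnt (fun s => J s t) := by
  rw [hEnt_add_sum_hEnt, hEnt_add_sum_hEnt (fun t s => J s t), sum_comm,
    sum_comm (f := fun s t => J s t * log (J s t))]

/-- The divergence dominates the squared distance of coordinates. -/
theorem sq_sub_le_crossEnt_sub {q r : S → ℝ} (hq : q ∈ stdSimplex ℝ S) (hr : r ∈ stdSimplex ℝ S)
    (hqr : ∀ s, q s ≠ 0 → r s ≠ 0) (s : S) : (q s - r s) ^ 2 ≤ 4 * (crossEnt q r - hEnt q) := by
  -- Squared Hellinger distance, from `log x ≤ x - 1` at `x = √(r/q)`. The factor 4 of the statement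
  -- comes from `(√q + √r)² ≤ 4`.
  have h1 : ∀ s, (√(q s) - √(r s)) ^ 2 ≤ q s * (log (q s) - log (r s)) - q s + r s := by
    intro s
    have hq0 := hq.1 s
    have hr0 := hr.1 s
    by_cases h : q s = 0
    · simp [h, sq_sqrt hr0]
    have hq1 : 0 < q s := lt_of_le_of_ne hq0 (Ne.symm h)
    have hr1 : 0 < r s := lt_of_le_of_ne hr0 (Ne.symm (hqr s h))
    have h2 : log (r s) - log (q s) = 2 * log (√(r s) / √(q s)) := by
      rw [log_div (by positivity) (by positivity), log_sqrt hr0, log_sqrt hq0]; ring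
    have h3 := log_le_sub_one_of_pos (show 0 < √(r s) / √(q s) by positivity)
    have h4 : q s * (√(r s) / √(q s)) = √(q s) * √(r s) := by
      have := mul_self_sqrt hq0
      field_simp
      rw [sq_sqrt hq0]
    have h5 : q s * log (√(r s) / √(q s)) ≤ √(q s) * √(r s) - q s := by
      rw [← h4]; nlinarith
    have h6 : log (q s) - log (r s) = - (2 * log (√(r s) / √(q s))) := by linarith
    rw [h6, sub_sq, sq_sqrt hq0, sq_sqrt hr0]
    nlinarith
  have h2 : ∑ s, (√(q s) - √(r s)) ^ 2 ≤ crossEnt q r - hEnt q := by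
    refine (sum_le_sum fun s _ => h1 s).trans (le_of_eq ?_)
    simp only [sum_add_distrib, sum_sub_distrib, mul_sub, hq.2, hr.2, crossEnt, hEnt, log_one,
      mul_zero, sum_const_zero]
    ring
  have h3 := (single_le_sum (f := fun s => (√(q s) - √(r s)) ^ 2) (fun s _ => sq_nonneg _)
    (mem_univ s)).trans h2
  have h4 : ∀ p ∈ stdSimplex ℝ S, √(p s) ≤ 1 := fun p hp => by
    rw [sqrt_le_one]
    rw [← hp.2]
    exact single_le_sum (fun i _ => hp.1 i) (mem_univ s)
  have h5 : q s - r s = (√(q s) - √(r s)) * (√(q s) + √(r s)) := by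
    nlinarith [mul_self_sqrt (hq.1 s), mul_self_sqrt (hr.1 s)]
  have h6 : (√(q s) + √(r s)) ^ 2 ≤ 4 := by
    nlinarith [h4 q hq, h4 r hr, sqrt_nonneg (q s), sqrt_nonneg (r s)]
  rw [h5, mul_pow]
  nlinarith [sq_nonneg (√(q s) - √(r s))]

end Entropy

/-! ### Marginals and product laws -/

section Marginal

variable {S : Type*} [Fintype S] {n : ℕ}

theorem sum_marginal_mul (q : (Fin n → S) → ℝ) (t : Fin n) (f : S → ℝ) :
    ∑ s, marginal q t s * f s = ∑ x, q x * f (x t) := by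
  classical
  simp only [marginal, sum_mul]
  rw [sum_comm]
  refine sum_congr rfl fun x _ => ?_
  simp

theorem sum_marginal (q : (Fin n → S) → ℝ) (t : Fin n) : ∑ s, marginal q t s = ∑ x, q x := by
  simpa using sum_marginal_mul q t 1

theorem marginal_nonneg {q : (Fin n → S) → ℝ} (hq : ∀ x, 0 ≤ q x) (t : Fin n) (s : S) :
    0 ≤ marginal q t s := by
  classical
  exact sum_nonneg fun x _ => by split_ifs <;> simp [hq]

theorem le_marginal {q : (Fin n → S) → ℝ} (hq : ∀ x, 0 ≤ q x) (t : Fin n) (x : Fin n → S) :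
    q x ≤ marginal q t (x t) := by
  classical
  have := single_le_sum (f := fun y => if y t = x t then q y else 0)
    (fun y _ => by split_ifs <;> simp [hq]) (mem_univ x)
  simpa [marginal] using this

theorem sum_prod_pi (f : Fin n → S → ℝ) : ∑ x : Fin n → S, ∏ t, f t (x t) = ∏ t, ∑ s, f t s := by
  classical
  rw [Finset.prod_univ_sum, Fintype.piFinset_univ]

theorem iidLaw_mem {p : S → ℝ} (hp : p ∈ stdSimplex ℝ S) :
    (iidLaw p : (Fin n → S) → ℝ) ∈ stdSimplex ℝ (Fin n → S) :=
  ⟨fun _ => prod_nonneg fun _ _ => hp.1 _, by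
    simp [iidLaw, sum_prod_pi (fun _ => p), hp.2]⟩

theorem prod_mem {p : Fin n → S → ℝ} (hp : ∀ t, p t ∈ stdSimplex ℝ S) :
    (fun x => ∏ t, p t (x t)) ∈ stdSimplex ℝ (Fin n → S) :=
  ⟨fun _ => prod_nonneg fun _ _ => (hp _).1 _, by simp [sum_prod_pi p, (hp _).2]⟩

theorem marginal_prod {p : Fin n → S → ℝ} (hp : ∀ t, p t ∈ stdSimplex ℝ S) (t : Fin n) :
    marginal (fun x => ∏ t, p t (x t)) t = p t := by
  classical
  funext s
  have h1 : ∀ x : Fin n → S, (if x t = s then ∏ t, p t (x t) else 0) =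
      ∏ t', (if t' = t then (if x t' = s then p t' (x t') else 0) else p t' (x t')) := by
    intro x
    split_ifs with h
    · refine prod_congr rfl fun t' _ => ?_
      by_cases ht : t' = t
      · subst ht; simp [h]
      · simp [ht]
    · symm
      exact prod_eq_zero (mem_univ t) (by simp [h])
  simp only [marginal, h1]
  rw [sum_prod_pi (fun t' s' => if t' = t then (if s' = s then p t' s' else 0) else p t' s')]
  rw [prod_eq_single t]
  · simp
  · intro t' _ ht
    simp [ht, (hp t').2]
  · simp

/-- Gibbs' inequality against the product of the normalized marginals, whose cross entropy is the
sum of the marginal entropies. -/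
theorem hEnt_le_sum_marginal {q : (Fin n → S) → ℝ} (hq : ∀ x, 0 ≤ q x) :
    hEnt q ≤ ∑ t, hEnt (marginal q t) := by
  set Z := ∑ x, q x with hZ
  have hZ0 : 0 ≤ Z := sum_nonneg fun x _ => hq x
  have hpos : ∀ x, q x ≠ 0 → 0 < q x := fun x h => lt_of_le_of_ne (hq x) (Ne.symm h)
  have hZpos : ∀ x, q x ≠ 0 → 0 < Z := fun x h =>
    (hpos x h).trans_le (single_le_sum (fun x _ => hq x) (mem_univ x))
  have hm : ∀ x t, q x ≠ 0 → 0 < marginal q t (x t) := fun x t h =>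
    (hpos x h).trans_le (le_marginal hq t x)
  refine (hEnt_le_crossEnt (r := fun x => ∏ t, marginal q t (x t) / Z) hq
    (fun x => prod_nonneg fun t _ => div_nonneg (marginal_nonneg hq _ _) hZ0)
    (fun x h => (prod_pos fun t _ => div_pos (hm x t h) (hZpos x h)).ne') ?_).trans (le_of_eq ?_)
  · rw [sum_prod_pi (fun t s => marginal q t s / Z)]
    refine prod_le_one (fun t _ => sum_nonneg fun s _ => div_nonneg (marginal_nonneg hq _ _) hZ0) ?_
    intro t _
    rw [← sum_div, sum_marginal]
    exact div_self_le_one Z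
  · simp only [hEnt, sum_marginal, ← hZ]
    simp only [sum_marginal_mul q _ (fun s => log Z - log (marginal q _ s)), crossEnt]
    rw [sum_comm, ← sum_neg_distrib]
    refine sum_congr rfl fun x _ => ?_
    by_cases h : q x = 0
    · simp [h]
    rw [log_prod (fun t _ => (div_pos (hm x t h) (hZpos x h)).ne'), ← mul_sum, ← mul_neg,
      ← sum_neg_distrib]
    congr 1
    refine sum_congr rfl fun t _ => ?_
    rw [log_div (hm x t h).ne' (hZpos x h).ne']; ring

theorem hEnt_prod {p : Fin n → S → ℝ} (hp : ∀ t, p t ∈ stdSimplex ℝ S) :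
    hEnt (fun x : Fin n → S => ∏ t, p t (x t)) = ∑ t, hEnt (p t) := by
  have h1 : ∀ t, hEnt (p t) = ∑ x : Fin n → S, (∏ t, p t (x t)) * (- log (p t (x t))) := by
    intro t
    rw [← sum_marginal_mul (fun x => ∏ t, p t (x t)) t (fun s => - log (p t s)), marginal_prod hp]
    simp [hEnt, (hp t).2]
  simp only [h1]
  rw [sum_comm]
  simp only [hEnt, (prod_mem hp).2]
  refine sum_congr rfl fun x _ => ?_
  by_cases h : ∏ t, p t (x t) = 0
  · simp [h]
  rw [log_prod (fun t ht h0 => h (prod_eq_zero ht h0)), ← mul_sum, log_one, zero_sub,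
    sum_neg_distrib]

theorem hEnt_iidLaw {p : S → ℝ} (hp : p ∈ stdSimplex ℝ S) :
    hEnt (iidLaw p : (Fin n → S) → ℝ) = n * hEnt p := by
  have : hEnt (iidLaw p : (Fin n → S) → ℝ) = _ := hEnt_prod (p := fun _ => p) fun _ => hp
  simpa using this

end Marginal

/-! ### Weak law of large numbers -/

section LLN

variable {S : Type*} [Fintype S]

theorem sum_fin_succ_pi {n : ℕ} (F : (Fin (n + 1) → S) → ℝ) :
    ∑ x, F x = ∑ s, ∑ x : Fin n → S, F (Fin.cons s x) := by
  rw [← (Fin.consEquiv (fun _ => S)).sum_comp, Fintype.sum_prod_type]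
  rfl

/-- Variances of independent centered variables add: peeling off the first coordinate leaves a cross
term that vanishes by `hg`. This feeds Chebyshev's inequality. -/
theorem sum_iidLaw_mul_sq {p : S → ℝ} (hp : p ∈ stdSimplex ℝ S) {g : S → ℝ}
    (hg : ∑ s, p s * g s = 0) (n : ℕ) :
    ∑ x : Fin n → S, iidLaw p x * (∑ t, g (x t)) ^ 2 = n * ∑ s, p s * g s ^ 2 := by
  induction n with
  | zero => simp
  | succ n ih =>
    rw [sum_fin_succ_pi]
    have h1 : ∀ s (x : Fin n → S),
        iidLaw p (Fin.cons s x : Fin (n + 1) → S) *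
          (∑ t, g ((Fin.cons s x : Fin (n + 1) → S) t)) ^ 2 =
        p s * g s ^ 2 * iidLaw p x + p s * g s * (2 * (iidLaw p x * ∑ t, g (x t))) +
          p s * (iidLaw p x * (∑ t, g (x t)) ^ 2) := by
      intro s x
      simp only [iidLaw, Fin.prod_univ_succ, Fin.sum_univ_succ, Fin.cons_zero, Fin.cons_succ]
      ring
    simp only [h1, sum_add_distrib, ← mul_sum, ← sum_mul, ih, hg, hp.2, (iidLaw_mem hp).2]
    push_cast
    ring

open scoped Classical in
/-- Weak law of large numbers. -/
theorem exists_forall_sum_iidLaw_le {p : S → ℝ} (hp : p ∈ stdSimplex ℝ S) (f : S → ℝ)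
    {ε δ : ℝ} (hε : 0 < ε) (hδ : 0 < δ) :
    ∃ N : ℕ, ∀ n ≥ N, ∑ x : Fin n → S with
      ¬ |∑ t, f (x t) - n * ∑ s, p s * f s| < n * ε, iidLaw p x ≤ δ := by
  set E := ∑ s, p s * f s with hE
  set v := ∑ s, p s * (f s - E) ^ 2 with hv
  have hv0 : 0 ≤ v := sum_nonneg fun s _ => mul_nonneg (hp.1 s) (sq_nonneg _)
  obtain ⟨N, hN⟩ := exists_nat_gt (v / (ε ^ 2 * δ))
  refine ⟨N + 1, fun n hn => ?_⟩
  have hn0 : (0 : ℝ) < n := by exact_mod_cast (by omega : 0 < n)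
  have hNn : (N : ℝ) ≤ n := by exact_mod_cast (by omega : N ≤ n)
  have hg : ∑ s, p s * (f s - E) = 0 := by
    simp only [mul_sub, sum_sub_distrib, ← sum_mul, hp.2, ← hE]; ring
  have h1 := sum_iidLaw_mul_sq hp hg n
  have h2 : (∑ x : Fin n → S with
      ¬ |∑ t, f (x t) - n * E| < n * ε, iidLaw p x) * (n * ε) ^ 2 ≤ n * v := by
    rw [← h1, sum_mul]
    refine (sum_le_sum fun x hx => ?_).trans
      (sum_le_univ_sum_of_nonneg fun x => mul_nonneg ((iidLaw_mem hp).1 x) (sq_nonneg _))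
    have h3 : ∑ t, (f (x t) - E) = ∑ t, f (x t) - n * E := by simp [sum_sub_distrib]
    rw [h3]
    have h4 := not_lt.1 (mem_filter.1 hx).2
    have h5 : (n * ε) ^ 2 ≤ (∑ t, f (x t) - n * E) ^ 2 := by
      rw [← sq_abs (∑ t, f (x t) - n * E)]
      gcongr
    exact mul_le_mul_of_nonneg_left h5 ((iidLaw_mem hp).1 x)
  rw [div_lt_iff₀ (by positivity)] at hN
  have h6 : v ≤ n * (ε ^ 2 * δ) := hN.le.trans (by gcongr)
  have h7 : (∑ x : Fin n → S with
      ¬ |∑ t, f (x t) - n * E| < n * ε, iidLaw p x) * (n * ε) ^ 2 ≤ δ * (n * ε) ^ 2 := by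
    refine h2.trans ?_
    calc n * v ≤ n * (n * (ε ^ 2 * δ)) := by gcongr
      _ = _ := by ring
  exact le_of_mul_le_mul_right h7 (by positivity)

end LLN

/-! ### The averaging argument -/

section Averages

variable {S : Type*} [Fintype S]

/-- Codewords are drawn from random choices through this lemma. With `f = 0` and `c = 0` it only
extracts an element of a type that carries a probability law. -/
theorem exists_le_of_le_sum {p : S → ℝ} (hp : p ∈ stdSimplex ℝ S) {f : S → ℝ} {c : ℝ}
    (h : c ≤ ∑ s, p s * f s) : ∃ s, c ≤ f s := by
  by_contra! hlt
  have h1 : ∑ s, p s * f s ≤ ∑ s, p s * c :=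
    sum_le_sum fun s _ => mul_le_mul_of_nonneg_left (hlt s).le (hp.1 s)
  have h2 : ∑ s, p s * (c - f s) = 0 := by
    have : ∑ s, p s * c = c := by rw [← sum_mul, hp.2, one_mul]
    simp only [mul_sub, sum_sub_distrib]; linarith
  have h3 := (sum_eq_zero_iff_of_nonneg fun s _ =>
    mul_nonneg (hp.1 s) (sub_nonneg.2 (hlt s).le)).1 h2
  have h4 : ∀ s, p s = 0 := fun s => by
    have := h3 s (mem_univ s)
    rcases mul_eq_zero.1 this with h | h
    · exact h
    · exact absurd h (sub_pos.2 (hlt s)).ne'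
  have := hp.2
  simp [h4] at this

end Averages

/-! ### One-shot channel coding and covering -/

section Coding

variable {X Y : Type*} [Fintype X] [Fintype Y]

open scoped Classical in
/-- Feinstein's lemma: greedy construction of a code with small maximal error. -/
theorem exists_code_of_le {p : X → ℝ} (hp : p ∈ stdSimplex ℝ X) {W : X → Y → ℝ}
    (hW : ∀ x, W x ∈ stdSimplex ℝ Y) {γ ε : ℝ} (hγ : 0 < γ) (M : ℕ)
    (h : M / γ + ∑ x, ∑ y with ¬ γ * ∑ x', p x' * W x' y < W x y, p x * W x y ≤ ε) :
    ∃ (c : ℕ → X) (d : Y → ℕ), ∀ i < M, 1 - ε ≤ ∑ y with d y = i, W (c i) y := by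
  set P : Y → ℝ := fun y => ∑ x', p x' * W x' y with hP
  have hP0 : ∀ y, 0 ≤ P y := fun y => sum_nonneg fun x _ => mul_nonneg (hp.1 x) ((hW x).1 y)
  -- Invariant of the greedy construction: labels below `M` are decoded messages, supported where
  -- the likelihood exceeds `γ * P`, and the label `M` means "not decoded yet".
  suffices H : ∃ (c : ℕ → X) (d : Y → ℕ), (∀ y, d y ≤ M) ∧
      (∀ y, d y < M → γ * P y < W (c (d y)) y) ∧
      ∀ i < M, 1 - ε ≤ ∑ y with d y = i, W (c i) y by
    obtain ⟨c, d, -, -, h⟩ := H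
    exact ⟨c, d, h⟩
  induction M with
  | zero =>
    obtain ⟨x, -⟩ := exists_le_of_le_sum (f := fun _ => (0 : ℝ)) (c := 0) hp (by simp)
    exact ⟨fun _ => x, fun _ => 0, by simp, by simp, by simp⟩
  | succ M ih =>
    obtain ⟨c, d, hd, hA, hc⟩ := ih (le_trans (by gcongr; simp) h)
    -- On a decoding region `γ * P` is below a probability law, so the region has output mass at
    -- most `1 / γ`. All regions together then cost at most `M / γ`.
    have hu : ∀ i < M, ∑ y with d y = i, P y ≤ 1 / γ := by
      intro i hi
      rw [le_div_iff₀ hγ, sum_mul]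
      refine le_trans ?_ (hW (c i)).2.le
      refine (sum_le_sum fun y hy => ?_).trans (sum_le_univ_sum_of_nonneg (hW (c i)).1)
      have h1 := (mem_filter.1 hy).2
      have := hA y (by omega)
      rw [h1] at this
      linarith
    have hD : ∑ y with d y < M, P y ≤ M / γ := by
      have h1 : ∑ y with d y < M, P y = ∑ i ∈ range M, ∑ y with d y = i, P y := by
        rw [← sum_fiberwise_of_maps_to (s := univ.filter fun y => d y < M) (t := range M) (g := d)
          (by simp)]
        refine sum_congr rfl fun i hi => ?_
        rw [filter_filter]
        refine sum_congr (filter_congr fun y _ => ?_) fun _ _ => rfl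
        have := mem_range.1 hi
        constructor <;> omega
      rw [h1]
      refine (sum_le_sum fun i hi => hu i (mem_range.1 hi)).trans ?_
      simp [div_eq_mul_inv]
    -- A random codeword has, on average, likelihood at least `1 - ε` on the outputs that are
    -- typical for it and still free. If no codeword could be added, the error budget `h` would be
    -- violated.
    have hx : 1 - ε ≤ ∑ x, p x * ∑ y with (γ * P y < W x y ∧ ¬ d y < M), W x y := by
      have h1 : (1 : ℝ) = ∑ x, ∑ y, p x * W x y := by
        simp [← mul_sum, (hW _).2, hp.2]
      have h2 : ∑ x, ∑ y with d y < M, p x * W x y = ∑ y with d y < M, P y := by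
        rw [sum_comm]
      have h3 : ∀ x, ∑ y, p x * W x y ≤ p x * ∑ y with (γ * P y < W x y ∧ ¬ d y < M), W x y +
          ∑ y with d y < M, p x * W x y + ∑ y with ¬ γ * P y < W x y, p x * W x y := by
        intro x
        simp only [mul_sum, sum_filter, ← sum_add_distrib]
        refine sum_le_sum fun y _ => ?_
        have := mul_nonneg (hp.1 x) ((hW x).1 y)
        by_cases h4 : γ * P y < W x y <;> by_cases h5 : d y < M <;> simp [h4, h5, this]
      have h4 := sum_le_sum fun x (_ : x ∈ univ) => h3 x
      rw [sum_add_distrib, sum_add_distrib, ← h1, h2] at h4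
      have h5 : (M : ℝ) / γ ≤ (M + 1 : ℕ) / γ := by gcongr; simp
      linarith
    obtain ⟨x, hx⟩ := exists_le_of_le_sum hp hx
    refine ⟨fun i => if i = M then x else c i,
      fun y => if d y < M then d y else if γ * P y < W x y then M else M + 1, ?_, ?_, ?_⟩
    · intro y
      dsimp only
      split_ifs <;> omega
    · intro y
      dsimp only
      split_ifs with h1 h2 h3 h4 h5
      · omega
      · intro _; exact hA y h1
      · intro _; exact h3
      all_goals intro h; omega
    · intro i hi
      by_cases h1 : i = M
      · subst h1
        simp only [if_true]
        refine hx.trans (le_of_eq (sum_congr (filter_congr fun y _ => ?_) fun _ _ => rfl))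
        split_ifs with h2 h3
        · simp [h2, h2.ne]
        · simp [h2, h3]
        · simp [h3]
      · simp only [h1, if_false]
        refine (hc i (by omega)).trans (le_of_eq (sum_congr (filter_congr fun y _ => ?_)
          fun _ _ => rfl))
        split_ifs with h2 h3
        · rfl
        · constructor <;> omega
        · constructor <;> omega

open scoped Classical in
/-- Greedy covering: a small codebook meets the good set `G` for most sources. -/
theorem exists_cover {P : X → ℝ} {PU : Y → ℝ} (hPU : PU ∈ stdSimplex ℝ Y)
    {J : X → Y → ℝ} (hJ : ∀ s u, 0 ≤ J s u) (hJP : ∀ s, ∑ u, J s u = P s)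
    (hP1 : ∑ s, P s ≤ 1)
    (G : X → Y → Prop) {γ : ℝ} (hγ : 1 ≤ γ) (hG : ∀ s u, G s u → J s u ≤ γ * (P s * PU u)) (M : ℕ) :
    ∃ c : ℕ → Y, ∑ s with (∀ i < M, ¬ G s (c i)), P s ≤
      ∑ s, ∑ u with ¬ G s u, J s u + (1 - 1 / γ) ^ M := by
  have hγ0 : 0 < γ := by linarith
  set g := ∑ s, ∑ u with ¬ G s u, J s u with hg
  have hg0 : 0 ≤ g := sum_nonneg fun s _ => sum_nonneg fun u _ => hJ s u
  have hP0 : ∀ s, 0 ≤ P s := fun s => by rw [← hJP]; exact sum_nonneg fun u _ => hJ s u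
  induction M with
  | zero =>
    obtain ⟨u, -⟩ := exists_le_of_le_sum (f := fun _ => (0 : ℝ)) (c := 0) hPU (by simp)
    refine ⟨fun _ => u, ?_⟩
    simp; linarith
  | succ M ih =>
    obtain ⟨c, hc⟩ := ih
    set R : X → Prop := fun s => ∀ i < M, ¬ G s (c i) with hR
    -- A codeword drawn from `PU` covers on average a `1 / γ` share of the uncovered mass in excess
    -- of `g`, since `J` is at most `γ` times the product law on `G`.
    have h1 : (∑ s with R s, P s - g) / γ ≤ ∑ u, PU u * ∑ s with (R s ∧ G s u), P s := by
      rw [div_le_iff₀ hγ0]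
      have h2 : ∑ s with R s, P s ≤ (∑ u, PU u * ∑ s with (R s ∧ G s u), P s) * γ + g := by
        simp only [hg, mul_sum, sum_mul, sum_filter]
        rw [sum_comm, ← sum_add_distrib]
        refine sum_le_sum fun s _ => ?_
        rw [← sum_add_distrib]
        by_cases h3 : R s
        · simp only [h3, if_true, true_and]
          rw [← hJP s]
          refine sum_le_sum fun u _ => ?_
          by_cases h4 : G s u
          · simp [h4]; rw [hJP]; linarith [hG s u h4]
          · simp [h4]
        · simp only [h3, if_false, false_and]
          refine sum_nonneg fun u _ => ?_
          split_ifs <;> simp [hJ]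
      linarith
    obtain ⟨u, hu⟩ := exists_le_of_le_sum hPU h1
    refine ⟨fun i => if i = M then u else c i, ?_⟩
    have h2 : ∑ s with (∀ i < M + 1, ¬ G s (if i = M then u else c i)), P s +
        ∑ s with (R s ∧ G s u), P s = ∑ s with R s, P s := by
      simp only [sum_filter, ← sum_add_distrib]
      refine sum_congr rfl fun s _ => ?_
      have h3 : (∀ i < M + 1, ¬ G s (if i = M then u else c i)) ↔ R s ∧ ¬ G s u := by
        constructor
        · intro h
          refine ⟨fun i hi => ?_, ?_⟩
          · have := h i (by omega)
            rwa [if_neg (by omega)] at this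
          · simpa using h M (by omega)
        · rintro ⟨h, h'⟩ i hi
          split_ifs with h4
          · exact h'
          · exact h i (by omega)
      simp only [h3]
      by_cases h4 : R s <;> by_cases h5 : G s u <;> simp [h4, h5]
    -- Each new codeword thus contracts the excess over `g` by the factor `1 - 1 / γ`.
    have h3 : (∑ s with R s, P s - g) * (1 - 1 / γ) ≤ (1 - 1 / γ) ^ M * (1 - 1 / γ) := by
      have : 0 ≤ 1 - 1 / γ := by
        rw [sub_nonneg, div_le_one hγ0]; exact hγ
      gcongr
      linarith
    rw [pow_succ]
    have h4 : (∑ s with R s, P s - g) * (1 - 1 / γ) = ∑ s with R s, P s - g -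
      (∑ s with R s, P s - g) / γ := by ring
    linarith

end Coding

/-! ### Channel coding and source covering at large block length -/

/-- Output law of a channel. -/
def outLaw {X Y : Type*} [Fintype X] (p : X → ℝ) (Q : X → Y → ℝ) (y : Y) : ℝ :=
  ∑ x, p x * Q x y

/-- Mutual information in nats. -/
def infoNat {X Y : Type*} [Fintype X] [Fintype Y] (p : X → ℝ) (Q : X → Y → ℝ) : ℝ :=
  hEnt (outLaw p Q) - ∑ x, p x * hEnt (Q x)

section Asymptotics

variable {X Y : Type*} [Fintype X] [Fintype Y] {p : X → ℝ} {Q : X → Y → ℝ}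

theorem outLaw_mem (hp : p ∈ stdSimplex ℝ X) (hQ : ∀ x, Q x ∈ stdSimplex ℝ Y) :
    outLaw p Q ∈ stdSimplex ℝ Y := by
  refine ⟨fun y => sum_nonneg fun x _ => mul_nonneg (hp.1 x) ((hQ x).1 y), ?_⟩
  simp only [outLaw]
  rw [sum_comm]
  simp [← mul_sum, (hQ _).2, hp.2]

theorem infoNat_nonneg (hp : p ∈ stdSimplex ℝ X) (hQ : ∀ x, Q x ∈ stdSimplex ℝ Y) :
    0 ≤ infoNat p Q := by
  have := sum_hEnt_le (fun x y => p x * Q x y) fun x y => mul_nonneg (hp.1 x) ((hQ x).1 y)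
  simp only [hEnt_smul (hQ _).1] at this
  exact sub_nonneg.2 this

theorem channelPow_mem {X : Type*} {Q : X → Y → ℝ} (hQ : ∀ x, Q x ∈ stdSimplex ℝ Y) {k : ℕ} (x : Fin k → X) :
    channelPow Q x ∈ stdSimplex ℝ (Fin k → Y) :=
  prod_mem (p := fun t => Q (x t)) fun t => hQ (x t)

theorem outLaw_channelPow {Y : Type*} {Q : X → Y → ℝ} {k : ℕ} (y : Fin k → Y) :
    outLaw (iidLaw p : (Fin k → X) → ℝ) (channelPow Q) y = iidLaw (outLaw p Q) y := by
  simp only [outLaw, iidLaw, channelPow, ← prod_mul_distrib]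
  exact sum_prod_pi fun t x => p x * Q x (y t)

theorem joint_mem (hp : p ∈ stdSimplex ℝ X) (hQ : ∀ x, Q x ∈ stdSimplex ℝ Y) :
    (fun z : X × Y => p z.1 * Q z.1 z.2) ∈ stdSimplex ℝ (X × Y) := by
  refine ⟨fun z => mul_nonneg (hp.1 _) ((hQ _).1 _), ?_⟩
  rw [Fintype.sum_prod_type]
  simp [← mul_sum, (hQ _).2, hp.2]

theorem sum_joint_mul_log (hp : p ∈ stdSimplex ℝ X) (hQ : ∀ x, Q x ∈ stdSimplex ℝ Y) :
    ∑ z : X × Y, p z.1 * Q z.1 z.2 * (log (Q z.1 z.2) - log (outLaw p Q z.2)) = infoNat p Q := by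
  rw [Fintype.sum_prod_type]
  simp only [mul_sub, sum_sub_distrib, infoNat, hEnt, (hQ _).2, (outLaw_mem hp hQ).2, log_one,
    zero_sub, mul_neg, mul_sum, sum_neg_distrib, mul_assoc]
  rw [sum_comm (f := fun x y => p x * (Q x y * log (outLaw p Q y)))]
  have : ∀ y, ∑ x, p x * (Q x y * log (outLaw p Q y)) = outLaw p Q y * log (outLaw p Q y) := by
    intro y; simp only [← mul_assoc, ← sum_mul]; rfl
  simp only [this]; ring

theorem sum_sum_mul_eq_sum_joint {k : ℕ} (G : (Fin k → X × Y) → ℝ) :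
    ∑ x : Fin k → X, ∑ y : Fin k → Y, iidLaw p x * channelPow Q x y * G (fun t => (x t, y t)) =
      ∑ z, iidLaw (fun z : X × Y => p z.1 * Q z.1 z.2) z * G z := by
  rw [← (Equiv.arrowProdEquivProdArrow (Fin k) (fun _ => X) (fun _ => Y)).symm.sum_comp,
    Fintype.sum_prod_type]
  refine sum_congr rfl fun x _ => sum_congr rfl fun y _ => ?_
  simp [Equiv.arrowProdEquivProdArrow, iidLaw, channelPow, prod_mul_distrib]

theorem sum_sum_filter_eq_sum_joint {k : ℕ} (B : (Fin k → X × Y) → Prop) [DecidablePred B] :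
    ∑ x : Fin k → X, ∑ y : Fin k → Y with B (fun t => (x t, y t)), iidLaw p x * channelPow Q x y =
      ∑ z with B z, iidLaw (fun z : X × Y => p z.1 * Q z.1 z.2) z := by
  simpa [sum_filter] using
    sum_sum_mul_eq_sum_joint (p := p) (Q := Q) fun z => if B z then 1 else 0

/-- The exponential of the information density is the likelihood ratio. -/
theorem channelPow_eq_exp_mul {k : ℕ} {x : Fin k → X} {y : Fin k → Y}
    (hp : p ∈ stdSimplex ℝ X) (hQ : ∀ x, Q x ∈ stdSimplex ℝ Y)
    (h : iidLaw p x * channelPow Q x y ≠ 0) :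
    0 < iidLaw (outLaw p Q) y ∧ channelPow Q x y =
      exp (∑ t, (log (Q (x t) (y t)) - log (outLaw p Q (y t)))) * iidLaw (outLaw p Q) y := by
  have h1 : ∀ t, 0 < p (x t) := fun t => lt_of_le_of_ne (hp.1 _) fun h0 => h (by
    rw [iidLaw, prod_eq_zero (mem_univ t) h0.symm, zero_mul])
  have h2 : ∀ t, 0 < Q (x t) (y t) := fun t => lt_of_le_of_ne ((hQ _).1 _) fun h0 => h (by
    rw [channelPow, prod_eq_zero (mem_univ t) h0.symm, mul_zero])
  have h3 : ∀ t, 0 < outLaw p Q (y t) := fun t => (mul_pos (h1 t) (h2 t)).trans_le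
    (single_le_sum (f := fun x => p x * Q x (y t))
      (fun x _ => mul_nonneg (hp.1 x) ((hQ x).1 _)) (mem_univ (x t)))
  refine ⟨prod_pos fun t _ => h3 t, ?_⟩
  simp only [channelPow, iidLaw, exp_sum, ← prod_mul_distrib]
  refine prod_congr rfl fun t _ => ?_
  rw [exp_sub, exp_log (h2 t), exp_log (h3 t), div_mul_cancel₀ _ (h3 t).ne']

theorem exists_forall_exp_neg_le {δ ε : ℝ} (hδ : 0 < δ) (hε : 0 < ε) :
    ∃ N : ℕ, ∀ n ≥ N, exp (-(n * δ)) ≤ ε := by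
  obtain ⟨N, hN⟩ := exists_nat_ge (-log ε / δ)
  refine ⟨N, fun n hn => ?_⟩
  rw [← exp_log hε, exp_le_exp]
  have : (N : ℝ) ≤ n := by exact_mod_cast hn
  rw [div_le_iff₀ hδ] at hN
  nlinarith

open scoped Classical in
/-- Channel coding theorem: rates below the mutual information are achievable. -/
theorem exists_channel_code (hp : p ∈ stdSimplex ℝ X) (hQ : ∀ x, Q x ∈ stdSimplex ℝ Y)
    {R ε : ℝ} (hR : R < infoNat p Q) (hε : 0 < ε) :
    ∃ k₀ : ℕ, ∀ k ≥ k₀, ∀ (I : Type) [Fintype I] [Nonempty I], (Fintype.card I : ℝ) ≤ exp (k * R) →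
      ∃ (c : I → Fin k → X) (d : (Fin k → Y) → I),
        ∀ i, ∑ y with d y ≠ i, channelPow Q (c i) y ≤ ε := by
  set δ := (infoNat p Q - R) / 2 with hδ
  have hδ0 : 0 < δ := by rw [hδ]; linarith
  set f : X × Y → ℝ := fun z => log (Q z.1 z.2) - log (outLaw p Q z.2) with hf
  obtain ⟨N₁, hN₁⟩ := exists_forall_sum_iidLaw_le (joint_mem hp hQ) f hδ0 (half_pos hε)
  obtain ⟨N₂, hN₂⟩ := exists_forall_exp_neg_le hδ0 (half_pos hε)
  refine ⟨max N₁ N₂, fun k hk I _ _ hI => ?_⟩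
  have h1 := hN₁ k (le_trans (le_max_left _ _) hk)
  have h2 := hN₂ k (le_trans (le_max_right _ _) hk)
  rw [sum_joint_mul_log hp hQ, ← sum_sum_filter_eq_sum_joint
    (fun z => ¬ |∑ t, f (z t) - k * infoNat p Q| < k * δ)] at h1
  -- The threshold rate `R + δ` equals `infoNat p Q - δ`, midway in the gap: the codebook costs at
  -- most `exp (-kδ)`, and typical pairs pass the likelihood test.
  have key : (Fintype.card I : ℝ) / exp (k * (R + δ)) +
      ∑ x : Fin k → X, ∑ y with ¬ exp (k * (R + δ)) * ∑ x', iidLaw p x' * channelPow Q x' y <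
        channelPow Q x y, iidLaw p x * channelPow Q x y ≤ ε := by
    have h3 : (Fintype.card I : ℝ) / exp (k * (R + δ)) ≤ ε / 2 := by
      refine le_trans ?_ h2
      rw [div_le_iff₀ (exp_pos _), ← exp_add]
      rwa [show -((k : ℝ) * δ) + k * (R + δ) = k * R by ring]
    have h4 : ∑ x : Fin k → X, ∑ y with ¬ exp (k * (R + δ)) *
        ∑ x', iidLaw p x' * channelPow Q x' y < channelPow Q x y, iidLaw p x * channelPow Q x y ≤
        ε / 2 := by
      refine le_trans (sum_le_sum fun x _ => ?_) h1
      simp only [sum_filter]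
      refine sum_le_sum fun y _ => ?_
      have h0 : 0 ≤ iidLaw p x * channelPow Q x y :=
        mul_nonneg ((iidLaw_mem hp).1 x) ((channelPow_mem hQ x).1 y)
      by_cases hz : iidLaw p x * channelPow Q x y = 0
      · simp [hz]
      obtain ⟨h5, h6⟩ := channelPow_eq_exp_mul hp hQ hz
      have h7 : ∑ x', iidLaw p x' * channelPow Q x' y = iidLaw (outLaw p Q) y :=
        outLaw_channelPow y
      rw [h7]
      by_cases h9 : |∑ t, f (x t, y t) - k * infoNat p Q| < k * δ
      · have h8 : exp (k * (R + δ)) * iidLaw (outLaw p Q) y < channelPow Q x y := by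
          rw [h6]
          refine mul_lt_mul_of_pos_right (exp_lt_exp.2 ?_) h5
          have := (abs_lt.1 h9).1
          have h10 : (k : ℝ) * (R + δ) = k * infoNat p Q - k * δ := by rw [hδ]; ring
          simp only [hf] at this
          linarith
        rw [if_neg (not_not.2 h8)]
        split_ifs; linarith
      · rw [if_pos h9]
        split_ifs <;> linarith
    linarith
  obtain ⟨c, d, hcd⟩ := exists_code_of_le (iidLaw_mem hp) (channelPow_mem hQ)
    (exp_pos (k * (R + δ))) (Fintype.card I) key
  let e := Fintype.equivFin I
  -- Outputs left undecoded are given an arbitrary message, which cannot increase any error.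
  refine ⟨fun i => c (e i), fun y => if h : d y < Fintype.card I then e.symm ⟨d y, h⟩ else
    Classical.arbitrary I, fun i => ?_⟩
  have h3 := hcd (e i) (e i).2
  have h4 : ∑ y with d y = e i, channelPow Q (c (e i)) y +
      ∑ y with ¬ d y = e i, channelPow Q (c (e i)) y = 1 := by
    rw [sum_filter_add_sum_filter_not]; exact (channelPow_mem hQ _).2
  have h5 : ∑ y with (if h : d y < Fintype.card I then e.symm ⟨d y, h⟩ else
      Classical.arbitrary I) ≠ i, channelPow Q (c (e i)) y ≤
      ∑ y with ¬ d y = e i, channelPow Q (c (e i)) y := by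
    refine sum_le_sum_of_subset_of_nonneg (fun y => ?_)
      fun y _ _ => (channelPow_mem hQ _).1 y
    simp only [mem_filter, mem_univ, true_and]
    intro h h'
    apply h
    rw [dif_pos (h' ▸ (e i).2), Equiv.symm_apply_eq]
    exact Fin.ext h'
  linarith

open scoped Classical in
/-- Covering theorem: a codebook whose rate exceeds the mutual information contains, for most
outputs `y`, an input sequence that scores well together with `y`. -/
theorem exists_source_code (hp : p ∈ stdSimplex ℝ X) (hQ : ∀ x, Q x ∈ stdSimplex ℝ Y)
    (F : X → Y → ℝ) {R ε : ℝ} (hR : infoNat p Q < R) (hε : 0 < ε) :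
    ∃ N : ℕ, ∀ n ≥ N, ∀ L : ℕ, exp (n * R) ≤ L → ∃ c : ℕ → Fin n → X,
      ∑ y : Fin n → Y with (∀ i < L, ¬ n * (∑ x, p x * ∑ y, Q x y * F x y - ε) <
        ∑ t, F (c i t) (y t)), iidLaw (outLaw p Q) y ≤ ε := by
  set δ := (R - infoNat p Q) / 2 with hδ
  have hδ0 : 0 < δ := by rw [hδ]; linarith
  set f : X × Y → ℝ := fun z => log (Q z.1 z.2) - log (outLaw p Q z.2) with hf
  set F' : X × Y → ℝ := fun z => F z.1 z.2 with hF'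
  have hε3 : 0 < ε / 3 := by linarith
  obtain ⟨N₁, hN₁⟩ := exists_forall_sum_iidLaw_le (joint_mem hp hQ) f hδ0 hε3
  obtain ⟨N₂, hN₂⟩ := exists_forall_exp_neg_le hδ0 hε3
  obtain ⟨N₃, hN₃⟩ := exists_forall_sum_iidLaw_le (joint_mem hp hQ) F' hε hε3
  refine ⟨max N₁ (max N₂ N₃), fun n hn L hL => ?_⟩
  have h1 := hN₁ n (le_trans (le_max_left _ _) hn)
  have h2 := hN₂ n (le_trans ((le_max_left _ _).trans (le_max_right _ _)) hn)
  have h3 := hN₃ n (le_trans ((le_max_right _ _).trans (le_max_right _ _)) hn)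
  set EF := ∑ x, p x * ∑ y, Q x y * F x y with hEF
  have hEF' : ∑ z : X × Y, p z.1 * Q z.1 z.2 * F' z = EF := by
    rw [Fintype.sum_prod_type, hEF]
    simp only [mul_sum, mul_assoc, hF']
  rw [sum_joint_mul_log hp hQ, ← sum_sum_filter_eq_sum_joint
    (fun z => ¬ |∑ t, f (z t) - n * infoNat p Q| < n * δ)] at h1
  rw [hEF', ← sum_sum_filter_eq_sum_joint
    (fun z => ¬ |∑ t, F' (z t) - n * EF| < n * ε)] at h3
  -- The rate of `γ` is `R - δ`, so `L / γ ≥ exp (nδ) ≥ nδ` and the uncovered remainder `(1 -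
  -- 1/γ)^L` is at most `exp (-nδ)`.
  set γ := exp (n * (infoNat p Q + δ)) with hγ
  have hinfo := infoNat_nonneg hp hQ
  have hγ1 : 1 ≤ γ := one_le_exp (by positivity)
  -- The source is the output `y` and the codeword is the input `x`. The bound on the information
  -- density is what the covering lemma needs; the bound on the score is what the code is for.
  let G : (Fin n → Y) → (Fin n → X) → Prop := fun y x =>
    ∑ t, f (x t, y t) ≤ n * (infoNat p Q + δ) ∧ n * (EF - ε) < ∑ t, F (x t) (y t)
  obtain ⟨c, hc⟩ := exists_cover (P := iidLaw (outLaw p Q)) (PU := iidLaw p)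
    (iidLaw_mem (n := n) hp) (J := fun y x => iidLaw p x * channelPow Q x y)
    (fun y x => mul_nonneg ((iidLaw_mem hp).1 x) ((channelPow_mem hQ x).1 y))
    (fun y => outLaw_channelPow y) (iidLaw_mem (outLaw_mem hp hQ)).2.le G hγ1
    (by
      rintro y x ⟨hG, -⟩
      by_cases hz : iidLaw p x * channelPow Q x y = 0
      · rw [hz]
        exact mul_nonneg (by linarith) (mul_nonneg ((iidLaw_mem (outLaw_mem hp hQ)).1 y)
          ((iidLaw_mem hp).1 x))
      obtain ⟨h5, h6⟩ := channelPow_eq_exp_mul hp hQ hz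
      rw [h6]
      have h7 : exp (∑ t, f (x t, y t)) ≤ γ := exp_le_exp.2 hG
      have h8 : 0 ≤ iidLaw (outLaw p Q) y * iidLaw p x := mul_nonneg h5.le ((iidLaw_mem hp).1 x)
      have := mul_le_mul_of_nonneg_right h7 h8
      simp only [hf] at this
      linarith) L
  refine ⟨c, ?_⟩
  have hbad : ∑ y : Fin n → Y, ∑ x with ¬ G y x, iidLaw p x * channelPow Q x y ≤
      ε / 3 + ε / 3 := by
    refine le_trans ?_ (add_le_add h1 h3)
    rw [sum_comm' (t' := univ) (s' := fun x => univ.filter fun y => ¬ G y x) (by simp),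
      ← sum_add_distrib]
    refine sum_le_sum fun x _ => ?_
    simp only [sum_filter]
    rw [← sum_add_distrib]
    refine sum_le_sum fun y _ => ?_
    have h0 : 0 ≤ iidLaw p x * channelPow Q x y :=
      mul_nonneg ((iidLaw_mem hp).1 x) ((channelPow_mem hQ x).1 y)
    by_cases hG : G y x
    · rw [if_neg (not_not.2 hG)]
      split_ifs <;> linarith
    · rw [if_pos hG]
      by_cases h5 : |∑ t, f (x t, y t) - n * infoNat p Q| < n * δ
      · by_cases h6 : |∑ t, F' (x t, y t) - n * EF| < n * ε
        · exfalso
          apply hG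
          refine ⟨?_, ?_⟩
          · have := (abs_lt.1 h5).2; linarith
          · have := (abs_lt.1 h6).1
            simp only [hF'] at this; linarith
        · rw [if_pos h6]; split_ifs; linarith
      · rw [if_pos h5]; split_ifs <;> linarith
  have hpow : (1 - 1 / γ) ^ L ≤ ε / 3 := by
    refine le_trans ?_ h2
    have h5 : 1 - 1 / γ ≤ exp (-(1 / γ)) := one_sub_le_exp_neg _
    have h6 : 0 ≤ 1 - 1 / γ := by
      rw [sub_nonneg, div_le_one (by linarith)]; exact hγ1
    refine (pow_le_pow_left₀ h6 h5 L).trans ?_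
    rw [← exp_nat_mul, exp_le_exp]
    have h7 : (n : ℝ) * δ ≤ L / γ := by
      rw [le_div_iff₀ (by linarith)]
      refine le_trans ?_ hL
      have : (n : ℝ) * R = n * δ + n * (infoNat p Q + δ) := by rw [hδ]; ring
      rw [this, exp_add]
      gcongr
      linarith [add_one_le_exp ((n : ℝ) * δ)]
    have h8 : (L : ℝ) * -(1 / γ) = -(L / γ) := by ring
    linarith
  refine le_trans (sum_le_sum_of_subset_of_nonneg (fun y => ?_)
    fun y _ _ => (iidLaw_mem (outLaw_mem hp hQ)).1 y) (hc.trans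
      ((add_le_add (le_trans (le_of_eq (by congr!)) hbad) hpow).trans (by linarith)))
  simp only [mem_filter, mem_univ, true_and]
  exact fun h i hi hG => h i hi hG.2

end Asymptotics

/-! ### The robust payoff as a function of the belief -/

section Robust

variable {Ω A : Type*} [Fintype Ω] [Fintype A] [Nonempty A] (uS uR : Ω → A → ℝ)

theorem optActions_nonempty (ν : Ω → ℝ) : (optActions uR ν).Nonempty := by
  obtain ⟨a, ha⟩ := Finite.exists_max (expPayoff uR ν)
  exact ⟨a, ha⟩

omit [Nonempty A] in
theorem robustPayoff_le {ν : Ω → ℝ} {a : A} (ha : a ∈ optActions uR ν) :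
    robustPayoff uS uR ν ≤ expPayoff uS ν a :=
  csInf_le (Set.toFinite _).bddBelow ⟨a, ha, rfl⟩

theorem exists_robustPayoff_eq (ν : Ω → ℝ) :
    ∃ a ∈ optActions uR ν, expPayoff uS ν a = robustPayoff uS uR ν :=
  ((optActions_nonempty uR ν).image (expPayoff uS ν)).csInf_mem (Set.toFinite _)

omit [Fintype A] [Nonempty A] in
theorem expPayoff_smul (c : ℝ) (ν : Ω → ℝ) (a : A) :
    expPayoff uS (fun ω => c * ν ω) a = c * expPayoff uS ν a := by
  simp [expPayoff, mul_sum, mul_assoc]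

/-- Lets the robust payoff be evaluated at unnormalized posteriors, null outputs included. -/
theorem robustPayoff_smul {c : ℝ} (hc : 0 ≤ c) (ν : Ω → ℝ) :
    robustPayoff uS uR (fun ω => c * ν ω) = c * robustPayoff uS uR ν := by
  rcases hc.eq_or_lt with rfl | hc
  · obtain ⟨a, -, ha⟩ := exists_robustPayoff_eq uS uR fun ω => 0 * ν ω
    rw [← ha]
    simp [expPayoff]
  have h1 : optActions uR (fun ω => c * ν ω) = optActions uR ν := by
    ext a
    simp [optActions, expPayoff_smul, mul_le_mul_iff_right₀ hc]
  refine le_antisymm ?_ ?_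
  · obtain ⟨a, ha, hv⟩ := exists_robustPayoff_eq uS uR ν
    rw [← hv, ← expPayoff_smul]
    exact robustPayoff_le _ _ (h1 ▸ ha)
  · obtain ⟨a, ha, hv⟩ := exists_robustPayoff_eq uS uR fun ω => c * ν ω
    rw [← hv, expPayoff_smul]
    exact mul_le_mul_of_nonneg_left (robustPayoff_le _ _ (h1 ▸ ha)) hc.le

omit [Nonempty A] in
theorem exists_abs_le : ∃ B : ℝ, 0 ≤ B ∧ ∀ ω a, |uS ω a| ≤ B := by
  obtain ⟨B, hB⟩ := (Set.finite_range fun z : Ω × A => |uS z.1 z.2|).bddAbove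
  exact ⟨max B 0, le_max_right _ _, fun ω a => (hB ⟨(ω, a), rfl⟩).trans (le_max_left _ _)⟩

theorem abs_robustPayoff_le {B : ℝ} (hB : ∀ ω a, |uS ω a| ≤ B) {q : Ω → ℝ} (hq : ∀ ω, 0 ≤ q ω) :
    |robustPayoff uS uR q| ≤ B * ∑ ω, q ω := by
  obtain ⟨a, -, ha⟩ := exists_robustPayoff_eq uS uR q
  rw [← ha, expPayoff, mul_sum]
  refine (abs_sum_le_sum_abs _ _).trans (sum_le_sum fun ω _ => ?_)
  rw [abs_mul, abs_of_nonneg (hq ω), mul_comm]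
  exact mul_le_mul_of_nonneg_right (hB ω a) (hq ω)

/-- A strictly suboptimal action stays suboptimal nearby, so with finitely many actions the set of
optimal actions can only shrink locally. A minimum over fewer actions can only rise, up to the
continuity of each payoff. -/
theorem robustPayoff_lowerSemicontinuous (ν : Ω → ℝ) {ε : ℝ} (hε : 0 < ε) :
    ∀ᶠ q in 𝓝 ν, robustPayoff uS uR ν - ε ≤ robustPayoff uS uR q := by
  have hcont : ∀ (u : Ω → A → ℝ) a, Continuous fun q => expPayoff u q a := fun u a => by
    unfold expPayoff; fun_prop
  have h1 : ∀ a, ∀ᶠ q in 𝓝 ν, a ∈ optActions uR q → a ∈ optActions uR ν := by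
    intro a
    by_cases ha : a ∈ optActions uR ν
    · exact Eventually.of_forall fun _ _ => ha
    · simp only [optActions, Set.mem_ofPred_eq, not_forall, not_le] at ha
      obtain ⟨b, hb⟩ := ha
      filter_upwards [(hcont uR a).continuousAt.eventually_lt (hcont uR b).continuousAt hb]
        with q hq h
      exact absurd (h b) (not_le.2 hq)
  have h2 : ∀ a, ∀ᶠ q in 𝓝 ν, expPayoff uS ν a - ε < expPayoff uS q a := fun a =>
    (hcont uS a).continuousAt.eventually_const_lt (by simp [hε])
  filter_upwards [eventually_all.2 h1, eventually_all.2 h2] with q hq1 hq2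
  obtain ⟨a, ha, hv⟩ := exists_robustPayoff_eq uS uR q
  have := robustPayoff_le uS uR (hq1 a ha)
  linarith [hq2 a]

end Robust

/-! ### From semicontinuity to a divergence penalty -/

section Linear

variable {Ω : Type*} [Fintype Ω]

/-- A bounded function that is lower semicontinuous at `ν` is bounded below by its value at `ν`
minus a multiple of the divergence from `ν`. -/
theorem exists_sub_mul_divergence_le {f : (Ω → ℝ) → ℝ} {B ε : ℝ}
    (hB : ∀ q ∈ stdSimplex ℝ Ω, |f q| ≤ B) {ν : Ω → ℝ} (hν : ν ∈ stdSimplex ℝ Ω) (hε : 0 ≤ ε)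
    (hf : ∀ᶠ q in 𝓝[{q | q ∈ stdSimplex ℝ Ω ∧ ∀ ω, ν ω = 0 → q ω = 0}] ν, f ν - ε ≤ f q) :
    ∃ K : ℝ, 0 ≤ K ∧ ∀ q ∈ stdSimplex ℝ Ω, (∀ ω, ν ω = 0 → q ω = 0) →
      f ν - ε - K * (crossEnt q ν - hEnt q) ≤ f q := by
  obtain ⟨η, hη, hball⟩ := Metric.mem_nhdsWithin_iff.1 hf
  have hB0 : 0 ≤ B := (abs_nonneg _).trans (hB ν hν)
  -- A divergence below `η² / 4` puts `q` in the ball of radius `η`, where semicontinuity applies.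
  -- Otherwise the penalty is at least `2 * B`, the largest possible oscillation of `f`.
  refine ⟨8 * B / η ^ 2, by positivity, fun q hq hqν => ?_⟩
  have hne : ∀ ω, q ω ≠ 0 → ν ω ≠ 0 := fun ω h h' => h (hqν ω h')
  have hD : 0 ≤ crossEnt q ν - hEnt q :=
    sub_nonneg.2 (hEnt_le_crossEnt hq.1 hν.1 hne hν.2.le)
  by_cases hlt : 4 * (crossEnt q ν - hEnt q) < η ^ 2
  · have h1 : f ν - ε ≤ f q := hball ⟨by
      rw [Metric.mem_ball, dist_pi_lt_iff hη]
      intro ω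
      rw [dist_eq]
      exact abs_lt_of_sq_lt_sq ((sq_sub_le_crossEnt_sub hq hν hne ω).trans_lt hlt) hη.le, hq, hqν⟩
    have : 0 ≤ 8 * B / η ^ 2 * (crossEnt q ν - hEnt q) := by positivity
    linarith
  · have h1 : 2 * B ≤ 8 * B / η ^ 2 * (crossEnt q ν - hEnt q) := by
      rw [div_mul_eq_mul_div, le_div_iff₀ (by positivity)]
      nlinarith
    have h2 := abs_le.1 (hB ν hν)
    have h3 := abs_le.1 (hB q hq)
    linarith

end Linear

/-! ### Best replies and the sender's guaranteed payoff -/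

section Game

variable {Ω A X Y : Type*} [Fintype Ω] [Fintype A] [Nonempty A] [Fintype X] [Fintype Y]
  {uS uR : Ω → A → ℝ} {μ : Ω → ℝ} {Q : X → Y → ℝ} {n k : ℕ}

/-- Joint law of the states and the output `y`. -/
def jointLaw (μ : Ω → ℝ) (Q : X → Y → ℝ) (σ : (Fin n → Ω) → (Fin k → X) → ℝ) (y : Fin k → Y)
    (ω : Fin n → Ω) : ℝ :=
  ∑ x, iidLaw μ ω * σ ω x * channelPow Q x y

/-- The sender's payoff from `σ` at the worst best reply. -/
def robustValue (uS uR : Ω → A → ℝ) (μ : Ω → ℝ) (Q : X → Y → ℝ)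
    (σ : (Fin n → Ω) → (Fin k → X) → ℝ) : ℝ :=
  1 / n * ∑ y, ∑ t, robustPayoff uS uR (marginal (jointLaw μ Q σ y) t)

omit [Fintype A] [Nonempty A] [Fintype Y] in
theorem sum_mul_avgPayoff (u : Ω → A → ℝ) (σ : (Fin n → Ω) → (Fin k → X) → ℝ) (y : Fin k → Y)
    (a : Fin n → A) :
    ∑ ω, ∑ x, iidLaw μ ω * σ ω x * channelPow Q x y * avgPayoff u ω a =
      1 / n * ∑ t, expPayoff u (marginal (jointLaw μ Q σ y) t) (a t) := by
  simp only [expPayoff, sum_marginal_mul _ _ (fun ω => u ω _), ← sum_mul]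
  rw [sum_comm, mul_sum]
  refine sum_congr rfl fun ω _ => ?_
  rw [← mul_sum, avgPayoff, jointLaw]
  ring

omit [Fintype A] [Nonempty A] [Fintype Y] in
-- The average payoff is a sum over problems, so optimality against all action sequences reduces to
-- deviations in one coordinate.
theorem mem_bestReplies_iff (hn : 0 < n) {σ : (Fin n → Ω) → (Fin k → X) → ℝ}
    {τ : (Fin k → Y) → (Fin n → A)} :
    τ ∈ bestReplies uR μ Q σ ↔ ∀ y t, τ y t ∈ optActions uR (marginal (jointLaw μ Q σ y) t) := by
  classical
  have hn' : (0 : ℝ) < 1 / n := by positivity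
  simp only [bestReplies, Set.mem_ofPred_eq, sum_mul_avgPayoff, mul_le_mul_iff_right₀ hn']
  refine forall_congr' fun y => ⟨fun h t b => ?_, fun h a => sum_le_sum fun t _ => h t (a t)⟩
  have h1 := h (Function.update (τ y) t b)
  rw [← add_sum_erase _ _ (mem_univ t), ← add_sum_erase _ _ (mem_univ t)] at h1
  have h2 : ∀ t' ∈ univ.erase t, expPayoff uR (marginal (jointLaw μ Q σ y) t')
      (Function.update (τ y) t b t') = expPayoff uR (marginal (jointLaw μ Q σ y) t') (τ y t') := by
    intro t' ht'
    rw [Function.update_of_ne (ne_of_mem_erase ht')]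
  rw [sum_congr rfl h2, Function.update_self] at h1
  linarith

omit [Fintype A] [Nonempty A] in
theorem senderPayoff_eq (σ : (Fin n → Ω) → (Fin k → X) → ℝ) (τ : (Fin k → Y) → (Fin n → A)) :
    senderPayoff uS μ Q σ τ =
      1 / n * ∑ y, ∑ t, expPayoff uS (marginal (jointLaw μ Q σ y) t) (τ y t) := by
  rw [mul_sum]
  simp only [← sum_mul_avgPayoff, senderPayoff]
  symm
  rw [sum_comm]
  exact sum_congr rfl fun ω _ => sum_comm

/-- The receiver's optimality conditions for distinct `(y, t)` are independent, so a single best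
reply attains the minimum in all of them at once. -/
theorem sInf_senderPayoff_eq (hn : 0 < n) (σ : (Fin n → Ω) → (Fin k → X) → ℝ) :
    sInf (senderPayoff uS μ Q σ '' bestReplies uR μ Q σ) = robustValue uS uR μ Q σ := by
  refine IsLeast.csInf_eq ⟨?_, ?_⟩
  · choose τ hτ hv using fun y t => exists_robustPayoff_eq uS uR (marginal (jointLaw μ Q σ y) t)
    exact ⟨τ, (mem_bestReplies_iff hn).2 hτ, by simp only [senderPayoff_eq, robustValue, hv]⟩
  · rintro _ ⟨τ, hτ, rfl⟩
    rw [senderPayoff_eq, robustValue]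
    gcongr with y _ t _
    exact robustPayoff_le _ _ ((mem_bestReplies_iff hn).1 hτ y t)

omit [Fintype A] [Nonempty A] in
theorem jointLaw_nonneg (hμ : μ ∈ stdSimplex ℝ Ω) (hQ : ∀ x, Q x ∈ stdSimplex ℝ Y)
    {σ : (Fin n → Ω) → (Fin k → X) → ℝ} (hσ : σ ∈ senderStrategies Ω X n k) (y : Fin k → Y)
    (ω : Fin n → Ω) : 0 ≤ jointLaw μ Q σ y ω :=
  sum_nonneg fun x _ => mul_nonneg (mul_nonneg ((iidLaw_mem hμ).1 ω) ((hσ ω).1 x))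
    ((channelPow_mem hQ x).1 y)

omit [Fintype Ω] [Fintype A] [Nonempty A] in
theorem sum_jointLaw (hQ : ∀ x, Q x ∈ stdSimplex ℝ Y)
    {σ : (Fin n → Ω) → (Fin k → X) → ℝ} (hσ : σ ∈ senderStrategies Ω X n k) (ω : Fin n → Ω) :
    ∑ y, jointLaw μ Q σ y ω = iidLaw μ ω := by
  simp only [jointLaw]
  rw [sum_comm]
  simp [← mul_sum, (channelPow_mem hQ _).2, (hσ ω).2]

omit [Fintype A] [Nonempty A] in
theorem sum_marginal_jointLaw (hμ : μ ∈ stdSimplex ℝ Ω) (hQ : ∀ x, Q x ∈ stdSimplex ℝ Y)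
    {σ : (Fin n → Ω) → (Fin k → X) → ℝ} (hσ : σ ∈ senderStrategies Ω X n k) (t : Fin n) (ω : Ω) :
    ∑ y, marginal (jointLaw μ Q σ y) t ω = μ ω := by
  classical
  have h1 : marginal (iidLaw μ) t ω = μ ω := congrFun (marginal_prod (p := fun _ => μ)
    (fun _ => hμ) t) ω
  rw [← h1]
  simp only [marginal]
  rw [sum_comm]
  refine sum_congr rfl fun x _ => ?_
  split_ifs with h
  · exact sum_jointLaw hQ hσ x
  · simp

omit [Fintype A] [Nonempty A] in
theorem sum_sum_jointLaw (hμ : μ ∈ stdSimplex ℝ Ω) (hQ : ∀ x, Q x ∈ stdSimplex ℝ Y)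
    {σ : (Fin n → Ω) → (Fin k → X) → ℝ} (hσ : σ ∈ senderStrategies Ω X n k) :
    ∑ y, ∑ ω, jointLaw μ Q σ y ω = 1 := by
  rw [sum_comm]
  simp only [sum_jointLaw hQ hσ]
  exact (iidLaw_mem hμ).2

theorem abs_robustValue_le (hn : 0 < n) (hμ : μ ∈ stdSimplex ℝ Ω) (hQ : ∀ x, Q x ∈ stdSimplex ℝ Y)
    {B : ℝ} (hB : ∀ ω a, |uS ω a| ≤ B)
    {σ : (Fin n → Ω) → (Fin k → X) → ℝ} (hσ : σ ∈ senderStrategies Ω X n k) :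
    |robustValue uS uR μ Q σ| ≤ B := by
  have hn' : (0 : ℝ) < n := by exact_mod_cast hn
  rw [robustValue, abs_mul, abs_of_pos (by positivity), one_div_mul_eq_div, div_le_iff₀ hn']
  calc |∑ y, ∑ t, robustPayoff uS uR (marginal (jointLaw μ Q σ y) t)|
      ≤ ∑ y, ∑ t : Fin n, B * ∑ ω, jointLaw μ Q σ y ω := by
        refine (abs_sum_le_sum_abs _ _).trans (sum_le_sum fun y _ => ?_)
        refine (abs_sum_le_sum_abs _ _).trans (sum_le_sum fun t _ => ?_)
        rw [← sum_marginal _ t]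
        exact abs_robustPayoff_le _ _ hB (marginal_nonneg (jointLaw_nonneg hμ hQ hσ y) t)
    _ = B * n := by
        simp only [sum_const, card_univ, Fintype.card_fin, nsmul_eq_mul, ← mul_sum,
          sum_sum_jointLaw hμ hQ hσ]
        ring

theorem optimalRobustPayoff_eq (hn : 0 < n) :
    optimalRobustPayoff uS uR μ Q n k = sSup (robustValue uS uR μ Q '' senderStrategies Ω X n k) := by
  simp only [optimalRobustPayoff, sInf_senderPayoff_eq hn]

theorem robustValue_le_optimalRobustPayoff (hn : 0 < n) (hμ : μ ∈ stdSimplex ℝ Ω)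
    (hQ : ∀ x, Q x ∈ stdSimplex ℝ Y)
    {σ : (Fin n → Ω) → (Fin k → X) → ℝ} (hσ : σ ∈ senderStrategies Ω X n k) :
    robustValue uS uR μ Q σ ≤ optimalRobustPayoff uS uR μ Q n k := by
  rw [optimalRobustPayoff_eq hn]
  obtain ⟨B, -, hB⟩ := exists_abs_le uS
  refine le_csSup ⟨B, ?_⟩ ⟨σ, hσ, rfl⟩
  rintro _ ⟨σ', hσ', rfl⟩
  exact (abs_le.1 (abs_robustValue_le hn hμ hQ hB hσ')).2

omit [Fintype Ω] [Fintype A] [Nonempty A] in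
-- The strategy that draws an index from the state sequence and transmits its codeword.
theorem senderStrategies_of_encoder {I : Type*} [Fintype I] {κ : (Fin n → Ω) → I → ℝ}
    (hκ : ∀ ω, κ ω ∈ stdSimplex ℝ I) (c : I → Fin k → X) :
    (fun ω x => open Classical in ∑ i, if c i = x then κ ω i else 0) ∈
      senderStrategies Ω X n k := by
  classical
  intro ω
  refine ⟨fun x => sum_nonneg fun i _ => ?_, ?_⟩
  · split_ifs <;> simp [(hκ ω).1 i]
  · rw [sum_comm]
    simp [(hκ ω).2]

end Game

/-! ### Capacity and block transmission -/

section Capacity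

variable {X Y : Type*} [Fintype X] [Fintype Y] {p : X → ℝ} {Q : X → Y → ℝ}

theorem mutualInfo_eq (hp : p ∈ stdSimplex ℝ X) (hQ : ∀ x, Q x ∈ stdSimplex ℝ Y) :
    mutualInfo p Q = infoNat p Q / log 2 := by
  have h := entropy_eq_hEnt (outLaw_mem hp hQ).2
  simp only [mutualInfo, infoNat, entropy_eq_hEnt (hQ _).2, sub_div, sum_div, ← mul_div_assoc]
  rw [← h]
  rfl

theorem bddAbove_mutualInfo (hQ : ∀ x, Q x ∈ stdSimplex ℝ Y) :
    BddAbove ((fun p => mutualInfo p Q) '' stdSimplex ℝ X) := by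
  refine ⟨log (Fintype.card Y) / log 2, ?_⟩
  rintro _ ⟨p, hp, rfl⟩
  have h2 := log_pos one_lt_two
  simp only [mutualInfo_eq hp hQ]
  gcongr
  have h1 := hEnt_le_log_card (outLaw_mem hp hQ)
  have h3 : 0 ≤ ∑ x, p x * hEnt (Q x) :=
    sum_nonneg fun x _ => mul_nonneg (hp.1 x) (hEnt_nonneg (hQ x).1)
  rw [infoNat]
  linarith

theorem infoNat_le_capacity (hp : p ∈ stdSimplex ℝ X) (hQ : ∀ x, Q x ∈ stdSimplex ℝ Y) :
    infoNat p Q ≤ capacity Q * log 2 := by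
  rw [← div_le_iff₀ (log_pos one_lt_two), ← mutualInfo_eq hp hQ]
  exact le_csSup (bddAbove_mutualInfo hQ) ⟨p, hp, rfl⟩

theorem stdSimplex_nonempty [Nonempty X] : (stdSimplex ℝ X).Nonempty := by
  classical
  exact ⟨_, single_mem_stdSimplex ℝ (Classical.arbitrary X)⟩

theorem capacity_nonneg [Nonempty X] (hQ : ∀ x, Q x ∈ stdSimplex ℝ Y) : 0 ≤ capacity Q := by
  obtain ⟨p, hp⟩ := stdSimplex_nonempty (X := X)
  have h1 := infoNat_le_capacity hp hQ
  have h2 := infoNat_nonneg hp hQ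
  have h3 := log_pos one_lt_two
  by_contra! h
  nlinarith

theorem exists_lt_infoNat [Nonempty X] (hQ : ∀ x, Q x ∈ stdSimplex ℝ Y) {c : ℝ}
    (hc : c < capacity Q * log 2) : ∃ p ∈ stdSimplex ℝ X, c < infoNat p Q := by
  rw [← div_lt_iff₀ (log_pos one_lt_two)] at hc
  obtain ⟨_, ⟨p, hp, rfl⟩, h⟩ := exists_lt_of_lt_csSup (stdSimplex_nonempty.image _) hc
  refine ⟨p, hp, ?_⟩
  simp only [mutualInfo_eq hp hQ] at h
  exact (div_lt_div_iff_of_pos_right (log_pos one_lt_two)).1 h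

/-- Blocks of `k` channel uses transmit at most `k` times the capacity. -/
theorem infoNat_channelPow_le (hQ : ∀ x, Q x ∈ stdSimplex ℝ Y) {k : ℕ} {pX : (Fin k → X) → ℝ}
    (hp : pX ∈ stdSimplex ℝ (Fin k → X)) :
    infoNat pX (channelPow Q) ≤ k * (capacity Q * log 2) := by
  classical
  have hm : ∀ t, marginal pX t ∈ stdSimplex ℝ X := fun t =>
    ⟨marginal_nonneg hp.1 t, by rw [sum_marginal, hp.2]⟩
  have h1 : ∀ t, marginal (outLaw pX (channelPow Q)) t = outLaw (marginal pX t) Q := by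
    intro t
    funext y
    have h2 : ∀ x, marginal (channelPow Q x) t = Q (x t) := fun x =>
      marginal_prod (p := fun t => Q (x t)) (fun t => hQ (x t)) t
    rw [outLaw, sum_marginal_mul pX t (fun x => Q x y)]
    simp only [← h2, marginal, outLaw]
    simp only [← sum_filter, mul_sum]
    rw [sum_comm]
  -- For a memoryless channel the conditional entropy is exactly additive, while the output entropy
  -- is only subadditive.
  have h2 : ∑ x, pX x * hEnt (channelPow Q x) = ∑ t, ∑ x, marginal pX t x * hEnt (Q x) := by
    simp only [sum_marginal_mul pX _ (fun x => hEnt (Q x))]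
    rw [sum_comm]
    refine sum_congr rfl fun x _ => ?_
    rw [← mul_sum]
    exact congrArg _ (hEnt_prod (p := fun t => Q (x t)) fun t => hQ (x t))
  have h3 := hEnt_le_sum_marginal (outLaw_mem hp (channelPow_mem hQ)).1
  calc infoNat pX (channelPow Q) ≤ ∑ t, infoNat (marginal pX t) Q := by
        simp only [infoNat, h2, sum_sub_distrib, ← h1]
        linarith
    _ ≤ ∑ t : Fin k, capacity Q * log 2 := sum_le_sum fun t _ => infoNat_le_capacity (hm t) hQ
    _ = _ := by simp

end Capacity

/-! ### The splitting problem -/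

section Splitting

variable {Ω A : Type*} [Fintype Ω] [Fintype A] [Nonempty A] {uS uR : Ω → A → ℝ} {μ : Ω → ℝ}

omit [Fintype A] [Nonempty A] in
theorem splittingInfo_eq {M : ℕ} {lam : Fin M → ℝ} {ν : Fin M → Ω → ℝ}
    (h : IsSplitting μ lam ν) : splittingInfo μ lam ν = infoNat lam ν / log 2 := by
  rw [← mutualInfo_eq h.weights h.posteriors, splittingInfo, mutualInfo]
  simp only [h.average]

theorem sum_mul_robustPayoff_le {B : ℝ} (hB : ∀ ω a, |uS ω a| ≤ B) {ι : Type*} [Fintype ι]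
    {lam : ι → ℝ} {ν : ι → Ω → ℝ} (hl : lam ∈ stdSimplex ℝ ι) (hν : ∀ i, ν i ∈ stdSimplex ℝ Ω) :
    ∑ i, lam i * robustPayoff uS uR (ν i) ≤ B := by
  calc ∑ i, lam i * robustPayoff uS uR (ν i) ≤ ∑ i, lam i * B := by
        refine sum_le_sum fun i _ => mul_le_mul_of_nonneg_left ?_ (hl.1 i)
        have := (abs_le.1 (abs_robustPayoff_le uS uR hB (hν i).1)).2
        rwa [(hν i).2, mul_one] at this
    _ = B := by rw [← sum_mul, hl.2, one_mul]

/-- Reindexing allows any finite message set, such as pairs `(y, t)` or an `Option` type, and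
information measured in nats. -/
theorem le_splittingValue {ι : Type*} [Fintype ι] {lam : ι → ℝ} {ν : ι → Ω → ℝ}
    (hl : lam ∈ stdSimplex ℝ ι) (hν : ∀ i, ν i ∈ stdSimplex ℝ Ω) (hav : outLaw lam ν = μ)
    {c : EReal} (hc : ((infoNat lam ν / log 2 : ℝ) : EReal) ≤ c) :
    ∑ i, lam i * robustPayoff uS uR (ν i) ≤ splittingValue uS uR μ c := by
  obtain ⟨B, -, hB⟩ := exists_abs_le uS
  let e := (Fintype.equivFin ι).symm
  have hs : IsSplitting μ (fun m => lam (e m)) (fun m => ν (e m)) := by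
    refine ⟨⟨fun m => hl.1 _, ?_⟩, fun m => hν _, fun ω => ?_⟩
    · rw [e.sum_comp]; exact hl.2
    · rw [e.sum_comp fun i => lam i * ν i ω]; exact congrFun hav ω
  refine le_csSup ⟨B, ?_⟩ ⟨_, _, _, hs, ?_, ?_⟩
  · rintro _ ⟨M, lam, ν, h, -, rfl⟩
    exact sum_mul_robustPayoff_le hB h.weights h.posteriors
  · rw [splittingInfo_eq hs]
    convert hc using 3
    have h1 : outLaw (fun m => lam (e m)) (fun m => ν (e m)) = outLaw lam ν := by
      funext ω
      exact e.sum_comp fun i => lam i * ν i ω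
    rw [infoNat, infoNat, h1, e.sum_comp fun i => lam i * hEnt (ν i)]
  · rw [e.sum_comp fun i => lam i * robustPayoff uS uR (ν i)]

omit [Fintype A] [Nonempty A] in
-- `0 ≤ c` makes the trivial splitting feasible, so the supremum is not over the empty set.
theorem splittingValue_le (hμ : μ ∈ stdSimplex ℝ Ω) {c : EReal} (hc : 0 ≤ c) {v : ℝ}
    (h : ∀ (M : ℕ) (lam : Fin M → ℝ) (ν : Fin M → Ω → ℝ), lam ∈ stdSimplex ℝ (Fin M) →
      (∀ m, ν m ∈ stdSimplex ℝ Ω) → outLaw lam ν = μ →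
      ((infoNat lam ν / log 2 : ℝ) : EReal) ≤ c → ∑ m, lam m * robustPayoff uS uR (ν m) ≤ v) :
    splittingValue uS uR μ c ≤ v := by
  refine csSup_le ⟨_, 1, fun _ => 1, fun _ => μ, ⟨⟨by simp, by simp⟩, fun _ => hμ, by simp⟩, ?_,
    rfl⟩ ?_
  · simpa [splittingInfo] using hc
  · rintro _ ⟨M, lam, ν, hs, hi, rfl⟩
    rw [splittingInfo_eq hs] at hi
    exact h M lam ν hs.weights hs.posteriors (funext hs.average) hi

/-- Mutual information is the expected divergence of the posteriors from the prior. -/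
theorem infoNat_eq_sum_divergence {ι : Type*} [Fintype ι] {lam : ι → ℝ} {ν : ι → Ω → ℝ}
    (hav : outLaw lam ν = μ) (hμ : μ ∈ stdSimplex ℝ Ω) :
    infoNat lam ν = ∑ i, lam i * (crossEnt (ν i) μ - hEnt (ν i)) := by
  have h1 : hEnt μ = ∑ i, lam i * crossEnt (ν i) μ := by
    have h2 : hEnt μ = -∑ ω, μ ω * log (μ ω) := by simp [hEnt, hμ.2]
    simp only [h2, crossEnt, mul_neg, sum_neg_distrib, mul_sum]
    rw [sum_comm]
    simp only [← mul_assoc, ← sum_mul, neg_inj]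
    exact sum_congr rfl fun ω _ => by rw [← hav]; rfl
  simp only [infoNat, hav, mul_sub, sum_sub_distrib, h1]

omit [Fintype Ω] in
theorem posterior_eq_zero {ι : Type*} [Fintype ι] {lam : ι → ℝ} {ν : ι → Ω → ℝ}
    (hl : ∀ i, 0 ≤ lam i) (hν : ∀ i ω, 0 ≤ ν i ω) (hav : outLaw lam ν = μ) {i : ι}
    (hi : 0 < lam i) {ω : Ω} (hω : μ ω = 0) : ν i ω = 0 := by
  rw [← hav, outLaw, sum_eq_zero_iff_of_nonneg fun i _ => mul_nonneg (hl i) (hν i ω)] at hω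
  exact (mul_eq_zero.1 (hω i (mem_univ i))).resolve_left hi.ne'

/-- Without information, only the trivial splitting is feasible. -/
theorem splittingValue_zero (hμ : μ ∈ stdSimplex ℝ Ω) :
    splittingValue uS uR μ 0 = robustPayoff uS uR μ := by
  refine le_antisymm (splittingValue_le hμ le_rfl fun M lam ν hl hν hav hi => ?_) ?_
  · have h1 : infoNat lam ν / log 2 ≤ 0 := by exact_mod_cast hi
    have h2 : infoNat lam ν ≤ 0 := by
      rw [div_le_iff₀ (log_pos one_lt_two)] at h1; simpa using h1
    rw [infoNat_eq_sum_divergence hav hμ] at h2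
    have hne : ∀ i, 0 < lam i → ∀ ω, ν i ω ≠ 0 → μ ω ≠ 0 := fun i hi ω h h' =>
      h (posterior_eq_zero hl.1 (fun i => (hν i).1) hav hi h')
    have h3 : ∀ i, 0 ≤ lam i * (crossEnt (ν i) μ - hEnt (ν i)) := by
      intro i
      rcases (hl.1 i).eq_or_lt with h | h
      · simp [← h]
      · exact mul_nonneg h.le (sub_nonneg.2 (hEnt_le_crossEnt (hν i).1 hμ.1 (hne i h) hμ.2.le))
    have h4 := (sum_eq_zero_iff_of_nonneg fun i _ => h3 i).1
      (le_antisymm h2 (sum_nonneg fun i _ => h3 i))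
    have h5 : ∀ i, lam i * robustPayoff uS uR (ν i) = lam i * robustPayoff uS uR μ := by
      intro i
      rcases (hl.1 i).eq_or_lt with h | h
      · simp [← h]
      · have h6 := (mul_eq_zero.1 (h4 i (mem_univ i))).resolve_left h.ne'
        -- Zero divergence forces every coordinate difference to vanish.
        have h7 : ν i = μ := by
          funext ω
          have := sq_sub_le_crossEnt_sub (hν i) hμ (hne i h) ω
          rw [h6, mul_zero] at this
          exact sub_eq_zero.1 (pow_eq_zero_iff two_ne_zero |>.1 (le_antisymm this (sq_nonneg _)))
        rw [h7]
    simp only [h5, ← sum_mul, hl.2, one_mul, le_refl]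
  · have hav : outLaw (fun _ : Unit => 1) (fun _ => μ) = μ := by funext; simp [outLaw]
    have := le_splittingValue (uS := uS) (uR := uR) (ι := Unit) (lam := fun _ => 1)
      (ν := fun _ => μ) (μ := μ) (c := 0) ⟨by simp, by simp⟩ (fun _ => hμ) hav
      (by simp [infoNat, hav])
    simpa using this

theorem splittingValue_mono (hμ : μ ∈ stdSimplex ℝ Ω) {c c' : EReal} (hc : 0 ≤ c) (h : c ≤ c') :
    splittingValue uS uR μ c ≤ splittingValue uS uR μ c' :=
  splittingValue_le hμ hc fun _ _ _ hl hν hav hi => le_splittingValue hl hν hav (hi.trans h)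

/-- Scaling down the information constraint by mixing with the trivial splitting. -/
theorem splittingValue_mul_le (hμ : μ ∈ stdSimplex ℝ Ω) {B : ℝ} (hB : ∀ ω a, |uS ω a| ≤ B)
    {c s : ℝ} (hc : 0 ≤ c) (hs : 1 ≤ s) :
    splittingValue uS uR μ ((s * c : ℝ) : EReal) ≤
      s * splittingValue uS uR μ (c : EReal) + (s - 1) * B := by
  have hs0 : 0 < s := by linarith
  refine splittingValue_le hμ (by exact_mod_cast (by positivity)) fun M lam ν hl hν hav hi => ?_
  have hi' : infoNat lam ν / log 2 ≤ s * c := by exact_mod_cast hi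
  have hs1 : s⁻¹ ≤ 1 := inv_le_one_of_one_le₀ hs
  -- `none` is an uninformative message of weight `1 - s⁻¹`; the information of the mixture is `s⁻¹`
  -- times that of the given splitting.
  have hav' : outLaw (fun o : Option (Fin M) => o.elim (1 - s⁻¹) fun m => s⁻¹ * lam m)
      (fun o => o.elim μ ν) = μ := by
    funext ω
    have : ∑ m, lam m * ν m ω = μ ω := congrFun hav ω
    simp only [outLaw, Fintype.sum_option, Option.elim, mul_assoc, ← mul_sum, this]
    ring
  have := le_splittingValue (uS := uS) (uR := uR) (ι := Option (Fin M)) (μ := μ)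
    (lam := fun o => o.elim (1 - s⁻¹) fun m => s⁻¹ * lam m) (ν := fun o => o.elim μ ν)
    (c := (c : EReal)) ?_ ?_ hav' ?_
  · simp only [Fintype.sum_option, Option.elim, mul_assoc, ← mul_sum] at this
    have h2 := (abs_le.1 (abs_robustPayoff_le uS uR hB hμ.1)).1
    rw [hμ.2, mul_one] at h2
    set v := ∑ m, lam m * robustPayoff uS uR (ν m)
    set V := splittingValue uS uR μ (c : EReal)
    have h3 : s * ((1 - s⁻¹) * robustPayoff uS uR μ + s⁻¹ * v) ≤ s * V := by gcongr
    have h4 : s * ((1 - s⁻¹) * robustPayoff uS uR μ + s⁻¹ * v) =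
        (s - 1) * robustPayoff uS uR μ + v := by field_simp
    have h5 : (s - 1) * -B ≤ (s - 1) * robustPayoff uS uR μ :=
      mul_le_mul_of_nonneg_left h2 (by linarith)
    linarith
  · refine ⟨?_, ?_⟩
    · rintro (_ | m)
      · simpa using hs1
      · exact mul_nonneg (by positivity) (hl.1 m)
    · simp [Fintype.sum_option, ← mul_sum, hl.2]
  · rintro (_ | m)
    · exact hμ
    · exact hν m
  · have h1 : infoNat (fun o : Option (Fin M) => o.elim (1 - s⁻¹) fun m => s⁻¹ * lam m)
      (fun o => o.elim μ ν) = s⁻¹ * infoNat lam ν := by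
      rw [infoNat, hav', infoNat, hav]
      simp only [Fintype.sum_option, Option.elim, mul_assoc, ← mul_sum]
      ring
    rw [h1]
    norm_cast
    rw [mul_div_assoc, inv_mul_le_iff₀ hs0]
    exact hi'

end Splitting

/-! ### Upper bound for every `n` and `k` -/

section Converse

variable {Ω A X Y : Type*} [Fintype Ω] [Fintype A] [Nonempty A] [Fintype X] [Fintype Y]
  {uS uR : Ω → A → ℝ} {μ : Ω → ℝ} {Q : X → Y → ℝ} {n k : ℕ}

/-- Data processing: the left side is the information between states and outputs. Swapping the chain
rule turns it into output entropy minus entropy of the output given the states. The latter is at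
least the entropy given the input, by concavity. -/
theorem hEnt_iidLaw_sub_le (hμ : μ ∈ stdSimplex ℝ Ω) (hQ : ∀ x, Q x ∈ stdSimplex ℝ Y)
    {σ : (Fin n → Ω) → (Fin k → X) → ℝ} (hσ : σ ∈ senderStrategies Ω X n k) :
    hEnt (iidLaw μ : (Fin n → Ω) → ℝ) - ∑ y, hEnt (jointLaw μ Q σ y) ≤
      k * (capacity Q * log 2) := by
  set pX : (Fin k → X) → ℝ := fun x => ∑ ω, iidLaw μ ω * σ ω x with hpX
  have hw : ∀ (ω : Fin n → Ω) x, 0 ≤ iidLaw μ ω * σ ω x := fun ω x =>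
    mul_nonneg ((iidLaw_mem hμ).1 ω) ((hσ ω).1 x)
  have hp : pX ∈ stdSimplex ℝ (Fin k → X) := by
    refine ⟨fun x => sum_nonneg fun ω _ => hw ω x, ?_⟩
    rw [hpX, sum_comm]
    simp [← mul_sum, (hσ _).2, (iidLaw_mem hμ).2]
  refine le_trans ?_ (infoNat_channelPow_le hQ hp)
  have h1 := hEnt_chain fun (ω : Fin n → Ω) (y : Fin k → Y) => jointLaw μ Q σ y ω
  simp only [sum_jointLaw hQ hσ] at h1
  have h2 : (fun y => ∑ ω, jointLaw μ Q σ y ω) = outLaw pX (channelPow Q) := by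
    funext y
    simp only [jointLaw, outLaw, hpX, sum_mul]
    rw [sum_comm]
  rw [h2] at h1
  have h3 : ∑ x, pX x * hEnt (channelPow Q x) ≤
      ∑ ω, hEnt (fun y => jointLaw μ Q σ y ω) := by
    simp only [hpX, sum_mul]
    rw [sum_comm]
    refine sum_le_sum fun ω _ => ?_
    have := sum_hEnt_le (fun x y => iidLaw μ ω * σ ω x * channelPow Q x y) fun x y =>
      mul_nonneg (hw ω x) ((channelPow_mem hQ x).1 y)
    simp only [hEnt_smul (channelPow_mem hQ _).1] at this
    exact this
  rw [infoNat]
  have h4 : hEnt (fun ω : Fin n → Ω => iidLaw μ ω) = hEnt (iidLaw μ : (Fin n → Ω) → ℝ) := rfl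
  linarith

/-- Single-letterization: the message is the output together with a uniform time index. The prior
entropy is exactly additive over time and the posterior entropies are subadditive, so this message
carries at most `1 / n` of the block information. -/
theorem robustValue_le_splittingValue (hn : 0 < n) (hμ : μ ∈ stdSimplex ℝ Ω)
    (hQ : ∀ x, Q x ∈ stdSimplex ℝ Y)
    {σ : (Fin n → Ω) → (Fin k → X) → ℝ} (hσ : σ ∈ senderStrategies Ω X n k) :
    robustValue uS uR μ Q σ ≤
      splittingValue uS uR μ (((k : ℝ) / (n : ℝ) * capacity Q : ℝ) : EReal) := by
  have hn' : (0 : ℝ) < n := by exact_mod_cast hn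
  set P : (Fin k → Y) → ℝ := fun y => ∑ ω, jointLaw μ Q σ y ω with hP
  have hJ := jointLaw_nonneg hμ hQ hσ
  have hP0 : ∀ y, 0 ≤ P y := fun y => sum_nonneg fun ω _ => hJ y ω
  set lam : (Fin k → Y) × Fin n → ℝ := fun z => 1 / n * P z.1 with hlam
  -- Outputs of probability zero have weight zero; the prior is a dummy posterior there.
  set ν : (Fin k → Y) × Fin n → Ω → ℝ := fun z ω => if P z.1 = 0 then μ ω else
    marginal (jointLaw μ Q σ z.1) z.2 ω / P z.1 with hν
  have hlν : ∀ z, (fun ω => lam z * ν z ω) =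
      fun ω => 1 / n * marginal (jointLaw μ Q σ z.1) z.2 ω := by
    intro z
    funext ω
    simp only [hlam, hν]
    split_ifs with h
    · have h1 : ∑ ω, marginal (jointLaw μ Q σ z.1) z.2 ω = 0 := by rw [sum_marginal]; exact h
      rw [sum_eq_zero_iff_of_nonneg fun ω _ => marginal_nonneg (hJ z.1) z.2 ω] at h1
      rw [h1 ω (mem_univ ω), h]; ring
    · field_simp
  have hl : lam ∈ stdSimplex ℝ ((Fin k → Y) × Fin n) := by
    refine ⟨fun z => mul_nonneg (by positivity) (hP0 _), ?_⟩
    rw [Fintype.sum_prod_type]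
    simp only [hlam, sum_const, card_univ, Fintype.card_fin, nsmul_eq_mul, ← mul_sum,
      hP, sum_sum_jointLaw hμ hQ hσ]
    field_simp
  have hνm : ∀ z, ν z ∈ stdSimplex ℝ Ω := by
    intro z
    by_cases h : P z.1 = 0
    · simp only [hν, h, if_true]; exact hμ
    · simp only [hν, h, if_false]
      refine ⟨fun ω => div_nonneg (marginal_nonneg (hJ z.1) z.2 ω) (hP0 _), ?_⟩
      rw [← sum_div, sum_marginal]
      exact div_self h
  have hav : outLaw lam ν = μ := by
    funext ω
    have h1 : ∀ z, lam z * ν z ω = 1 / n * marginal (jointLaw μ Q σ z.1) z.2 ω := fun z =>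
      congrFun (hlν z) ω
    simp only [outLaw, h1]
    rw [Fintype.sum_prod_type_right]
    simp only [← mul_sum, sum_marginal_jointLaw hμ hQ hσ, sum_const, card_univ, Fintype.card_fin,
      nsmul_eq_mul]
    field_simp
  have h2 : ∑ z, lam z * robustPayoff uS uR (ν z) = robustValue uS uR μ Q σ := by
    have h3 : ∀ z, lam z * robustPayoff uS uR (ν z) =
        1 / n * robustPayoff uS uR (marginal (jointLaw μ Q σ z.1) z.2) := by
      intro z
      rw [← robustPayoff_smul uS uR (hl.1 z), hlν, robustPayoff_smul _ _ (by positivity)]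
    simp only [h3, robustValue]
    rw [Fintype.sum_prod_type]
    simp only [mul_sum]
  rw [← h2]
  refine le_splittingValue hl hνm hav ?_
  have h4 : ∑ z, lam z * hEnt (ν z) = 1 / n * ∑ y, ∑ t, hEnt (marginal (jointLaw μ Q σ y) t) := by
    have h3 : ∀ z, lam z * hEnt (ν z) = 1 / n * hEnt (marginal (jointLaw μ Q σ z.1) z.2) := by
      intro z
      rw [← hEnt_smul (hνm z).1, hlν, hEnt_smul (marginal_nonneg (hJ z.1) z.2)]
    simp only [h3]
    rw [Fintype.sum_prod_type]
    simp only [mul_sum]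
  have h5 : ∑ y, hEnt (jointLaw μ Q σ y) ≤ ∑ y, ∑ t, hEnt (marginal (jointLaw μ Q σ y) t) :=
    sum_le_sum fun y _ => hEnt_le_sum_marginal (hJ y)
  have h6 := hEnt_iidLaw_sub_le hμ hQ hσ
  rw [hEnt_iidLaw hμ] at h6
  norm_cast
  rw [div_le_iff₀ (log_pos one_lt_two), infoNat, hav, h4, one_div_mul_eq_div]
  have h7 : (k : ℝ) / n * capacity Q * log 2 = (k * (capacity Q * log 2)) / n := by ring
  rw [h7, le_div_iff₀ hn', sub_mul, div_mul_cancel₀ _ hn'.ne']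
  linarith

theorem optimalRobustPayoff_le [Nonempty X] (hn : 0 < n) (hμ : μ ∈ stdSimplex ℝ Ω)
    (hQ : ∀ x, Q x ∈ stdSimplex ℝ Y) :
    optimalRobustPayoff uS uR μ Q n k ≤
      splittingValue uS uR μ (((k : ℝ) / (n : ℝ) * capacity Q : ℝ) : EReal) := by
  rw [optimalRobustPayoff_eq hn]
  obtain ⟨p, hp⟩ := stdSimplex_nonempty (X := Fin k → X)
  refine csSup_le ⟨_, fun _ => p, fun _ => hp, rfl⟩ ?_
  rintro _ ⟨σ, hσ, rfl⟩
  exact robustValue_le_splittingValue hn hμ hQ hσ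

end Converse

/-! ### Payoff of an encoder combined with a channel code -/

section Encoder

variable {Ω A X Y ι : Type*} [Fintype Ω] [Fintype A] [Nonempty A] [Fintype X] [Fintype Y]
  {uS uR : Ω → A → ℝ} {μ : Ω → ℝ} {Q : X → Y → ℝ} {n k : ℕ}

/-- Babbling: an input drawn independently of the states leaves every posterior at the prior. -/
theorem robustPayoff_le_optimalRobustPayoff [Nonempty X] (hn : 0 < n) (hμ : μ ∈ stdSimplex ℝ Ω)
    (hQ : ∀ x, Q x ∈ stdSimplex ℝ Y) :
    robustPayoff uS uR μ ≤ optimalRobustPayoff uS uR μ Q n k := by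
  classical
  have hn' : (0 : ℝ) < n := by exact_mod_cast hn
  obtain ⟨p, hp⟩ := stdSimplex_nonempty (X := Fin k → X)
  refine le_of_eq_of_le ?_ (robustValue_le_optimalRobustPayoff hn hμ hQ (σ := fun _ => p)
    fun _ => hp)
  have h1 : ∀ y t, marginal (jointLaw μ Q (fun _ : Fin n → Ω => p) y) t =
      fun ω => outLaw p (channelPow Q) y * μ ω := by
    intro y t
    funext ω
    have h2 : marginal (iidLaw μ) t ω = μ ω := congrFun (marginal_prod (p := fun _ => μ)
      (fun _ => hμ) t) ω
    rw [← h2]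
    simp only [marginal, mul_sum, mul_ite, mul_zero]
    refine sum_congr rfl fun x _ => ?_
    split_ifs
    · rw [jointLaw, outLaw, sum_mul]
      exact sum_congr rfl fun x' _ => by ring
    · rfl
  have hb := outLaw_mem hp (channelPow_mem hQ)
  simp only [robustValue, h1, robustPayoff_smul uS uR (hb.1 _), sum_const, card_univ,
    Fintype.card_fin, nsmul_eq_mul, ← mul_sum, ← sum_mul, hb.2]
  field_simp

/-- Score of the posterior `ν m` at the state `ω`. -/
def score (uS uR : Ω → A → ℝ) (K : ℝ) (ν : ι → Ω → ℝ) (m : ι) (ω : Ω) : ℝ :=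
  robustPayoff uS uR (ν m) + K * log (ν m ω)

/-- Cross entropy is linear in `q`, so the penalized bound becomes an expected score plus `K` times
an entropy, both homogeneous in `q`. The score adds up over coordinates, and the entropy can be
bounded for the whole block. -/
theorem sum_score_le_robustPayoff {ν : Ω → ℝ} {K ε : ℝ}
    (hlin : ∀ q ∈ stdSimplex ℝ Ω, (∀ ω, ν ω = 0 → q ω = 0) →
      robustPayoff uS uR ν - ε - K * (crossEnt q ν - hEnt q) ≤ robustPayoff uS uR q)
    {q : Ω → ℝ} (hq : ∀ ω, 0 ≤ q ω) (hqν : ∀ ω, ν ω = 0 → q ω = 0) :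
    ∑ ω, q ω * (robustPayoff uS uR ν + K * log (ν ω)) - ε * ∑ ω, q ω + K * hEnt q ≤
      robustPayoff uS uR q := by
  have h0 : 0 ≤ ∑ ω, q ω := sum_nonneg fun ω _ => hq ω
  set Z := ∑ ω, q ω with hZ
  set q' : Ω → ℝ := fun ω => q ω / Z with hq'
  rcases h0.eq_or_lt with h | h
  · have h1 : q = fun ω => 0 * q ω := by
      funext ω
      rw [zero_mul]
      exact (sum_eq_zero_iff_of_nonneg fun ω _ => hq ω).1 h.symm ω (mem_univ ω)
    rw [← h, h1, robustPayoff_smul _ _ le_rfl, hEnt_smul hq]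
    simp
  · have h1 : q = fun ω => Z * q' ω := by
      funext ω
      simp only [hq']
      field_simp
    have hq'0 : q' ∈ stdSimplex ℝ Ω :=
      ⟨fun ω => div_nonneg (hq ω) h.le, by rw [hq', ← sum_div]; exact div_self h.ne'⟩
    have h2 := hlin q' hq'0 fun ω hω => by simp [hq', hqν ω hω]
    have h3 : ∑ ω, q ω * (robustPayoff uS uR ν + K * log (ν ω)) =
        Z * (robustPayoff uS uR ν - K * crossEnt q' ν) := by
      have h4 : ∑ ω, q ω * log (ν ω) = Z * ∑ ω, q' ω * log (ν ω) := by
        rw [h1]; simp only [mul_sum, mul_assoc]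
      simp only [mul_add, sum_add_distrib, ← sum_mul, mul_left_comm _ K, ← mul_sum, h4, crossEnt]
      rw [← hZ]; ring
    rw [h3, h1, robustPayoff_smul _ _ h.le, hEnt_smul hq'0.1]
    have h5 := mul_le_mul_of_nonneg_left h2 h.le
    linarith

/-- Payoff guaranteed by an encoder followed by a channel code. -/
theorem encoder_payoff_le (hn : 0 < n) (hμ : μ ∈ stdSimplex ℝ Ω) (hQ : ∀ x, Q x ∈ stdSimplex ℝ Y)
    {ν : ι → Ω → ℝ} (hfull : ∀ m ω, ν m ω = 0 → μ ω = 0) {K ε B e : ℝ} (hK : 0 ≤ K)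
    (hlin : ∀ m, ∀ q ∈ stdSimplex ℝ Ω, (∀ ω, ν m ω = 0 → q ω = 0) →
      robustPayoff uS uR (ν m) - ε - K * (crossEnt q (ν m) - hEnt q) ≤ robustPayoff uS uR q)
    (hB : ∀ m ω, |score uS uR K ν m ω| ≤ B) (hB0 : 0 ≤ B)
    {I : Type*} [Fintype I] [DecidableEq I] {κ : (Fin n → Ω) → I → ℝ}
    (hκ : ∀ ω, κ ω ∈ stdSimplex ℝ I)
    (c : I → Fin k → X) (d : (Fin k → Y) → I)
    (he : ∀ i, ∑ y with d y ≠ i, channelPow Q (c i) y ≤ e) (w : I → Fin n → ι) :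
    ∑ i, ∑ ω, iidLaw μ ω * κ ω i * ∑ t, score uS uR K ν (w i t) (ω t) +
      K * ∑ i, hEnt (fun ω => iidLaw μ ω * κ ω i) - n * (ε + 2 * B * e) ≤
      n * optimalRobustPayoff uS uR μ Q n k := by
  classical
  have hn' : (0 : ℝ) < n := by exact_mod_cast hn
  have hσ := senderStrategies_of_encoder hκ c
  set σ : (Fin n → Ω) → (Fin k → X) → ℝ := fun ω x => ∑ i, if c i = x then κ ω i else 0 with hσd
  refine le_trans ?_ (mul_le_mul_of_nonneg_left
    (robustValue_le_optimalRobustPayoff hn hμ hQ hσ) hn'.le)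
  have hJ := jointLaw_nonneg hμ hQ hσ
  have hiid := (iidLaw_mem (n := n) hμ).1
  have hJe : ∀ y ω, jointLaw μ Q σ y ω = ∑ i, channelPow Q (c i) y * (iidLaw μ ω * κ ω i) := by
    intro y ω
    simp only [jointLaw, hσd, mul_sum, sum_mul]
    rw [sum_comm]
    refine sum_congr rfl fun i _ => ?_
    rw [sum_eq_single (c i)]
    · simp; ring
    · intro x _ hx; simp [Ne.symm hx]
    · simp
  -- An output may be assigned any target posterior, for instance after a decoding error, so each
  -- target must charge the whole support of `μ`.
  have hm0 : ∀ y t m ω, ν m ω = 0 → marginal (jointLaw μ Q σ y) t ω = 0 := by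
    intro y t m ω hω
    have h1 := sum_marginal_jointLaw hμ hQ hσ t ω
    rw [hfull m ω hω, sum_eq_zero_iff_of_nonneg fun y _ => marginal_nonneg (hJ y) t ω] at h1
    exact h1 y (mem_univ y)
  set S : I → (Fin n → Ω) → ℝ := fun i ω => ∑ t, score uS uR K ν (w i t) (ω t) with hS
  have hSB : ∀ i ω, |S i ω| ≤ n * B := by
    intro i ω
    refine (abs_sum_le_sum_abs _ _).trans ((sum_le_sum fun t _ => hB _ _).trans ?_)
    simp
  -- The posterior at time `t` is compared with the target named by the decoded word; subadditivity
  -- replaces the marginal entropies by the block entropy.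
  have h1 : ∀ y, ∑ ω, jointLaw μ Q σ y ω * S (d y) ω - ε * (n * ∑ ω, jointLaw μ Q σ y ω) +
      K * hEnt (jointLaw μ Q σ y) ≤
      ∑ t, robustPayoff uS uR (marginal (jointLaw μ Q σ y) t) := by
    intro y
    have h2 := sum_le_sum fun t (_ : t ∈ univ) => sum_score_le_robustPayoff (hlin (w (d y) t))
      (marginal_nonneg (hJ y) t) (hm0 y t _)
    refine le_trans ?_ h2
    simp only [sum_add_distrib, sum_sub_distrib, sum_marginal, sum_const, card_univ,
      Fintype.card_fin, nsmul_eq_mul]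
    have h3 := mul_le_mul_of_nonneg_left (hEnt_le_sum_marginal (hJ y)) hK
    have h4 : ∑ t, ∑ ω, marginal (jointLaw μ Q σ y) t ω *
        (robustPayoff uS uR (ν (w (d y) t)) + K * log (ν (w (d y) t) ω)) =
        ∑ ω, jointLaw μ Q σ y ω * S (d y) ω := by
      have h5 : ∀ t, ∑ ω, marginal (jointLaw μ Q σ y) t ω *
        (robustPayoff uS uR (ν (w (d y) t)) + K * log (ν (w (d y) t) ω)) =
        ∑ ω, jointLaw μ Q σ y ω * score uS uR K ν (w (d y) t) (ω t) := fun t =>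
          sum_marginal_mul _ t (score uS uR K ν (w (d y) t))
      simp only [h5, hS, mul_sum]
      rw [sum_comm]
    rw [h4, ← mul_sum]
    linarith
  have h2 := sum_le_sum fun y (_ : y ∈ univ) => h1 y
  simp only [sum_add_distrib, sum_sub_distrib, ← mul_sum, sum_sum_jointLaw hμ hQ hσ] at h2
  have h3 : n * robustValue uS uR μ Q σ =
      ∑ y, ∑ t, robustPayoff uS uR (marginal (jointLaw μ Q σ y) t) := by
    rw [robustValue]; field_simp
  rw [h3]
  refine le_trans ?_ h2
  -- The law given `y` is a mixture of the laws given the index, so by concavity channel noise only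
  -- increases the conditional entropy of the states.
  have h4 : ∑ i, hEnt (fun ω => iidLaw μ ω * κ ω i) ≤ ∑ y, hEnt (jointLaw μ Q σ y) := by
    have h5 : ∀ y, ∑ i, channelPow Q (c i) y * hEnt (fun ω => iidLaw μ ω * κ ω i) ≤
        hEnt (jointLaw μ Q σ y) := by
      intro y
      have := sum_hEnt_le (fun i ω => channelPow Q (c i) y * (iidLaw μ ω * κ ω i)) fun i ω =>
        mul_nonneg ((channelPow_mem hQ _).1 y) (mul_nonneg (hiid ω) ((hκ ω).1 i))
      simp only [hEnt_smul fun ω => mul_nonneg (hiid ω) ((hκ ω).1 _)] at this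
      rwa [← funext (hJe y)] at this
    refine le_trans (le_of_eq ?_) (sum_le_sum fun y _ => h5 y)
    rw [sum_comm]
    simp [← sum_mul, (channelPow_mem hQ _).2]
  -- A decoding error changes the total score by at most `2 * (n * B)`.
  have h5 : ∀ i ω, S i ω - 2 * (n * B) * e ≤ ∑ y, channelPow Q (c i) y * S (d y) ω := by
    intro i ω
    have h6 : ∀ y, channelPow Q (c i) y * S i ω -
        (2 * (n * B)) * (if d y ≠ i then channelPow Q (c i) y else 0) ≤
        channelPow Q (c i) y * S (d y) ω := by
      intro y
      have h7 := (channelPow_mem hQ (c i)).1 y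
      split_ifs with h8
      · have h9 := abs_le.1 (hSB i ω)
        have h10 := abs_le.1 (hSB (d y) ω)
        nlinarith
      · rw [not_not.1 h8]; simp
    have h7 := sum_le_sum fun y (_ : y ∈ univ) => h6 y
    rw [sum_sub_distrib, ← sum_mul, (channelPow_mem hQ _).2, ← mul_sum, ← sum_filter] at h7
    have h8 := mul_le_mul_of_nonneg_left (he i) (show 0 ≤ 2 * (n * B) by positivity)
    linarith
  have h6 : ∑ i, ∑ ω, iidLaw μ ω * κ ω i * S i ω - 2 * (n * B) * e ≤
      ∑ y, ∑ ω, jointLaw μ Q σ y ω * S (d y) ω := by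
    have h7 : ∑ y, ∑ ω, jointLaw μ Q σ y ω * S (d y) ω =
        ∑ i, ∑ ω, iidLaw μ ω * κ ω i * ∑ y, channelPow Q (c i) y * S (d y) ω := by
      simp only [hJe, sum_mul, mul_sum]
      rw [sum_comm, sum_comm (s := (univ : Finset I))]
      refine sum_congr rfl fun ω _ => ?_
      rw [sum_comm]
      exact sum_congr rfl fun i _ => sum_congr rfl fun y _ => by ring
    have h8 : ∑ i, ∑ ω, iidLaw μ ω * κ ω i * (S i ω - 2 * (n * B) * e) =
        ∑ i, ∑ ω, iidLaw μ ω * κ ω i * S i ω - 2 * (n * B) * e := by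
      simp only [mul_sub, sum_sub_distrib, ← sum_mul]
      congr 1
      rw [sum_comm]
      simp [← mul_sum, (hκ _).2, (iidLaw_mem hμ).2]
    rw [h7, ← h8]
    exact sum_le_sum fun i _ => sum_le_sum fun ω _ =>
      mul_le_mul_of_nonneg_left (h5 i ω) (mul_nonneg (hiid ω) ((hκ ω).1 i))
  have h7 := mul_le_mul_of_nonneg_left h4 hK
  linarith

end Encoder

/-! ### Achievability of splittings -/

section Achievability

variable {Ω A X Y : Type*} [Fintype Ω] [Fintype A] [Nonempty A] [Fintype X] [Nonempty X]
  [Fintype Y] {uS uR : Ω → A → ℝ} {μ : Ω → ℝ} {Q : X → Y → ℝ}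

omit [Nonempty X] in
theorem sum_iidLaw_mul_sum {p : X → ℝ} (hp : p ∈ stdSimplex ℝ X) (f : X → ℝ) (n : ℕ) :
    ∑ x : Fin n → X, iidLaw p x * ∑ t, f (x t) = n * ∑ x, p x * f x := by
  simp only [mul_sum]
  rw [sum_comm]
  have h1 : ∀ t : Fin n, ∑ x : Fin n → X, iidLaw p x * f (x t) = ∑ x, p x * f x := by
    intro t
    rw [← sum_marginal_mul]
    have : marginal (iidLaw p) t = p := marginal_prod (p := fun _ => p) (fun _ => hp) t
    rw [this]
  simp [h1, mul_sum]

omit [Fintype A] [Nonempty A] in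
theorem exists_score_bound {ι : Type*} [Fintype ι] (uS uR : Ω → A → ℝ) (K : ℝ) (ν : ι → Ω → ℝ) :
    ∃ B : ℝ, 0 ≤ B ∧ ∀ m ω, |score uS uR K ν m ω| ≤ B := by
  obtain ⟨B, hB⟩ := (Set.finite_range fun z : ι × Ω => |score uS uR K ν z.1 z.2|).bddAbove
  exact ⟨max B 0, le_max_right _ _, fun m ω => (hB ⟨(m, ω), rfl⟩).trans (le_max_left _ _)⟩

/-- Divergence is nonnegative, so the sum of the individual constants serves all posteriors. -/
theorem exists_common_linear_bound {ι : Type*} [Fintype ι] {ν : ι → Ω → ℝ}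
    (hν : ∀ i, ν i ∈ stdSimplex ℝ Ω) {ε : ℝ} (hε : 0 < ε) :
    ∃ K : ℝ, 0 ≤ K ∧ ∀ m, ∀ q ∈ stdSimplex ℝ Ω, (∀ ω, ν m ω = 0 → q ω = 0) →
      robustPayoff uS uR (ν m) - ε - K * (crossEnt q (ν m) - hEnt q) ≤ robustPayoff uS uR q := by
  obtain ⟨B, -, hB⟩ := exists_abs_le uS
  have hB' : ∀ q ∈ stdSimplex ℝ Ω, |robustPayoff uS uR q| ≤ B := fun q hq => by
    simpa [hq.2] using abs_robustPayoff_le uS uR hB hq.1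
  choose K hK0 hK using fun m => exists_sub_mul_divergence_le hB' (hν m) hε.le
    (nhdsWithin_le_nhds (robustPayoff_lowerSemicontinuous uS uR (ν m) hε))
  refine ⟨∑ m, K m, sum_nonneg fun m _ => hK0 m, fun m q hq hqν => ?_⟩
  refine le_trans ?_ (hK m q hq hqν)
  have h1 : 0 ≤ crossEnt q (ν m) - hEnt q := sub_nonneg.2
    (hEnt_le_crossEnt hq.1 (hν m).1 (fun ω h h' => h (hqν ω h')) (hν m).2.le)
  have h2 : K m ≤ ∑ m, K m := single_le_sum (fun m _ => hK0 m) (mem_univ m)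
  have := mul_le_mul_of_nonneg_right h2 h1
  linarith

omit [Fintype A] [Nonempty A] in
-- At the target joint law the score loses `K` times the conditional entropy, exactly what the
-- entropy term of `encoder_payoff_le` is to give back.
theorem sum_mul_sum_score {ι : Type*} [Fintype ι] {lam : ι → ℝ} {ν : ι → Ω → ℝ}
    (hν : ∀ i, ν i ∈ stdSimplex ℝ Ω) (K : ℝ) :
    ∑ m, lam m * ∑ ω, ν m ω * score uS uR K ν m ω =
      ∑ m, lam m * robustPayoff uS uR (ν m) - K * ∑ m, lam m * hEnt (ν m) := by
  have h1 : ∀ m, ∑ ω, ν m ω * score uS uR K ν m ω =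
      robustPayoff uS uR (ν m) - K * hEnt (ν m) := by
    intro m
    simp only [score, hEnt, mul_add, sum_add_distrib, ← sum_mul, (hν m).2, log_one, zero_sub,
      mul_neg, sum_neg_distrib, mul_left_comm _ K, ← mul_sum]
    ring
  simp only [h1, mul_sub, sum_sub_distrib, mul_left_comm _ K, ← mul_sum]

/-- With a fixed number of problems and many channel uses, the sender can communicate the
realization of any splitting. -/
theorem exists_forall_le_optimalRobustPayoff_of_fixed {M : ℕ} {lam : Fin M → ℝ}
    {ν : Fin M → Ω → ℝ} (hl : lam ∈ stdSimplex ℝ (Fin M)) (hν : ∀ i, ν i ∈ stdSimplex ℝ Ω)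
    (hav : outLaw lam ν = μ) (hfull : ∀ m ω, ν m ω = 0 → μ ω = 0)
    (hQ : ∀ x, Q x ∈ stdSimplex ℝ Y) (hC : 0 < capacity Q) {ε : ℝ} (hε : 0 < ε) {n : ℕ}
    (hn : 0 < n) :
    ∃ k₀ : ℕ, ∀ k ≥ k₀, ∑ m, lam m * robustPayoff uS uR (ν m) - ε ≤
      optimalRobustPayoff uS uR μ Q n k := by
  classical
  have hn' : (0 : ℝ) < n := by exact_mod_cast hn
  have hμ : μ ∈ stdSimplex ℝ Ω := hav ▸ outLaw_mem hl hν
  obtain ⟨K, hK, hlin⟩ := exists_common_linear_bound (uS := uS) (uR := uR) hν (half_pos hε)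
  obtain ⟨B, hB0, hB⟩ := exists_score_bound uS uR K ν
  obtain ⟨p, hp, hpI⟩ := exists_lt_infoNat hQ (mul_pos hC (log_pos one_lt_two))
  have he : 0 < ε / (4 * B + 4) := by positivity
  obtain ⟨k₁, hk₁⟩ := exists_channel_code hp hQ (half_lt_self hpI) he
  -- Ensures that the `M ^ n` message words fit the rate `infoNat p Q / 2`, through `x + 1 ≤ exp x`.
  obtain ⟨k₂, hk₂⟩ := exists_nat_ge ((M : ℝ) ^ n / (infoNat p Q / 2))
  refine ⟨max k₁ k₂, fun k hk => ?_⟩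
  obtain ⟨m₀, -⟩ := exists_le_of_le_sum (f := fun _ => (0 : ℝ)) (c := 0) hl (by simp)
  have : Nonempty (Fin M) := ⟨m₀⟩
  obtain ⟨c, d, hcd⟩ := hk₁ k (le_trans (le_max_left _ _) hk) (Fin n → Fin M) (by
    have h1 : (k₂ : ℝ) ≤ k := by exact_mod_cast le_trans (le_max_right _ _) hk
    rw [div_le_iff₀ (by positivity)] at hk₂
    have h2 : (k₂ : ℝ) * (infoNat p Q / 2) ≤ k * (infoNat p Q / 2) := by gcongr
    have h3 := add_one_le_exp ((k : ℝ) * (infoNat p Q / 2))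
    simp only [Fintype.card_pi, Fintype.card_fin, prod_const, card_univ, Nat.cast_pow]
    linarith)
  have hsum : ∀ ω : Fin n → Ω, ∑ i, iidLaw lam i * channelPow ν i ω = iidLaw μ ω := fun ω => by
    rw [← hav]; exact outLaw_channelPow ω
  have hterm : ∀ (ω : Fin n → Ω) i, 0 ≤ iidLaw lam i * channelPow ν i ω := fun ω i =>
    mul_nonneg ((iidLaw_mem hl).1 i) ((channelPow_mem hν i).1 ω)
  -- Bayes' rule: the message word is drawn from its conditional law given the states, so the joint
  -- law is exactly that of the splitting. State sequences of probability zero get an arbitrary law.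
  set κ : (Fin n → Ω) → (Fin n → Fin M) → ℝ := fun ω i => if iidLaw μ ω = 0 then iidLaw lam i else
    iidLaw lam i * channelPow ν i ω / iidLaw μ ω with hκd
  have hκ : ∀ ω, κ ω ∈ stdSimplex ℝ (Fin n → Fin M) := by
    intro ω
    by_cases h : iidLaw μ ω = 0
    · simp only [hκd, h, if_true]; exact iidLaw_mem hl
    · simp only [hκd, h, if_false]
      refine ⟨fun i => div_nonneg (hterm ω i) ((iidLaw_mem hμ).1 ω), ?_⟩
      rw [← sum_div, hsum, div_self h]
  have hjoint : ∀ ω i, iidLaw μ ω * κ ω i = iidLaw lam i * channelPow ν i ω := by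
    intro ω i
    by_cases h : iidLaw μ ω = 0
    · rw [h, zero_mul]
      rw [← hsum, sum_eq_zero_iff_of_nonneg fun i _ => hterm ω i] at h
      exact (h i (mem_univ i)).symm
    · simp only [hκd, h, if_false]; field_simp
  have key := encoder_payoff_le hn hμ hQ hfull hK hlin hB hB0 hκ c d
    (e := ε / (4 * B + 4)) (by convert hcd) id
  simp only [hjoint, id] at key
  have h1 : ∑ i : Fin n → Fin M, ∑ ω : Fin n → Ω, iidLaw lam i * channelPow ν i ω *
      ∑ t, score uS uR K ν (i t) (ω t) = n * (∑ m, lam m * ∑ ω, ν m ω * score uS uR K ν m ω) := by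
    have h2 := sum_sum_mul_eq_sum_joint (p := lam) (Q := ν) (k := n)
      fun z => ∑ t, score uS uR K ν (z t).1 (z t).2
    rw [h2, sum_iidLaw_mul_sum (joint_mem hl hν) fun z => score uS uR K ν z.1 z.2,
      Fintype.sum_prod_type]
    simp only [mul_sum, mul_assoc]
  have h2 : ∑ i : Fin n → Fin M, hEnt (fun ω : Fin n → Ω => iidLaw lam i * channelPow ν i ω) =
      n * ∑ m, lam m * hEnt (ν m) := by
    rw [← sum_iidLaw_mul_sum hl]
    refine sum_congr rfl fun i _ => ?_
    rw [hEnt_smul (channelPow_mem hν i).1]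
    exact congrArg _ (hEnt_prod (p := fun t => ν (i t)) fun t => hν (i t))
  rw [h1, h2, sum_mul_sum_score hν] at key
  have h3 : 2 * B * (ε / (4 * B + 4)) ≤ ε / 2 := by
    rw [mul_div_assoc', div_le_div_iff₀ (by positivity) (by positivity)]
    nlinarith
  have h4 : (n : ℝ) * (∑ m, lam m * robustPayoff uS uR (ν m) - (ε / 2 + 2 * B * (ε / (4 * B + 4))))
      ≤ n * optimalRobustPayoff uS uR μ Q n k := by linarith
  have h5 := le_of_mul_le_mul_left h4 hn'
  linarith

/-- A splitting whose information is below the available capacity is asymptotically achievable. -/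
theorem exists_forall_le_optimalRobustPayoff {M : ℕ} {lam : Fin M → ℝ}
    {ν : Fin M → Ω → ℝ} (hl : lam ∈ stdSimplex ℝ (Fin M)) (hν : ∀ i, ν i ∈ stdSimplex ℝ Ω)
    (hav : outLaw lam ν = μ) (hfull : ∀ m ω, ν m ω = 0 → μ ω = 0)
    (hQ : ∀ x, Q x ∈ stdSimplex ℝ Y) {r : ℝ} (hr : 0 < r)
    (hinfo : infoNat lam ν < r * (capacity Q * log 2)) {ε : ℝ} (hε : 0 < ε) :
    ∃ N : ℕ, ∀ n ≥ N, 0 < n → ∀ k : ℕ, r * n ≤ k →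
      ∑ m, lam m * robustPayoff uS uR (ν m) - ε ≤ optimalRobustPayoff uS uR μ Q n k := by
  classical
  have hμ : μ ∈ stdSimplex ℝ Ω := hav ▸ outLaw_mem hl hν
  have hε4 : 0 < ε / 4 := by positivity
  obtain ⟨K, hK, hlin⟩ := exists_common_linear_bound (uS := uS) (uR := uR) hν hε4
  obtain ⟨B, hB0, hB⟩ := exists_score_bound uS uR K ν
  rw [mul_comm, ← div_lt_iff₀ hr] at hinfo
  obtain ⟨Rc, hRc1, hRc2⟩ := exists_between hinfo
  obtain ⟨p, hp, hpI⟩ := exists_lt_infoNat hQ hRc2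
  rw [div_lt_iff₀ hr] at hRc1
  have he : 0 < ε / 4 / (2 * B + 1) := by positivity
  -- The first bound lets the rate `infoNat lam ν + 2 * ρ` fit the channel; the second keeps the
  -- entropy lost to excess rate, weighted by `K`, below `ε / 4`.
  set ρ := min ((Rc * r - infoNat lam ν) / 2) (ε / 4 / (2 * K + 1)) with hρ
  have hρ0 : 0 < ρ := lt_min (by linarith) (by positivity)
  have hρ1 : infoNat lam ν + 2 * ρ ≤ Rc * r := by
    have := min_le_left ((Rc * r - infoNat lam ν) / 2) (ε / 4 / (2 * K + 1))
    rw [← hρ] at this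
    linarith
  have hρ2 : K * (2 * ρ) ≤ ε / 4 := by
    have := min_le_right ((Rc * r - infoNat lam ν) / 2) (ε / 4 / (2 * K + 1))
    rw [← hρ, le_div_iff₀ (by positivity)] at this
    nlinarith
  have hRc0 : 0 < Rc := by
    have := infoNat_nonneg hl hν
    by_contra! h
    nlinarith
  obtain ⟨k₀, hk₀⟩ := exists_channel_code hp hQ hpI he
  obtain ⟨N₁, hN₁⟩ := exists_source_code hl hν (score uS uR K ν)
    (show infoNat lam ν < infoNat lam ν + ρ by linarith) he
  obtain ⟨N₂, hN₂⟩ := exists_nat_ge (k₀ / r)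
  obtain ⟨N₃, hN₃⟩ := exists_nat_ge (log 2 / ρ)
  refine ⟨max N₁ (max N₂ N₃), fun n hnN hn k hk => ?_⟩
  have hn' : (0 : ℝ) < n := by exact_mod_cast hn
  have hnN₂ : (N₂ : ℝ) ≤ n := by
    exact_mod_cast le_trans ((le_max_left _ _).trans (le_max_right _ _)) hnN
  have hnN₃ : (N₃ : ℝ) ≤ n := by
    exact_mod_cast le_trans ((le_max_right _ _).trans (le_max_right _ _)) hnN
  have hkk : k₀ ≤ k := by
    have h1 := hN₂.trans hnN₂
    rw [div_le_iff₀ hr] at h1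
    exact_mod_cast (show (k₀ : ℝ) ≤ k by linarith)
  have hlog : log 2 ≤ n * ρ := by
    have h1 := hN₃.trans hnN₃
    rwa [div_le_iff₀ hρ0] at h1
  -- Large enough for covering at excess rate `ρ`; rounding up stays within excess rate `2 * ρ` once
  -- `n * ρ ≥ log 2`.
  set L := ⌈exp (n * (infoNat lam ν + ρ))⌉₊ with hL
  have hL1 : exp (n * (infoNat lam ν + ρ)) ≤ L := Nat.le_ceil _
  have hL2 : (L : ℝ) ≤ exp (n * (infoNat lam ν + 2 * ρ)) := by
    have h1 : (L : ℝ) < exp (n * (infoNat lam ν + ρ)) + 1 := Nat.ceil_lt_add_one (exp_pos _).le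
    have h2 : 1 ≤ exp (n * (infoNat lam ν + ρ)) := one_le_exp (by
      have := infoNat_nonneg hl hν
      positivity)
    have h3 : exp (n * (infoNat lam ν + 2 * ρ)) =
        exp (n * (infoNat lam ν + ρ)) * exp (n * ρ) := by rw [← exp_add]; ring_nf
    have h4 : 2 ≤ exp (n * ρ) := by rw [← exp_log two_pos]; exact exp_le_exp.2 hlog
    rw [h3]
    nlinarith
  have hLpos : 0 < L := Nat.ceil_pos.2 (exp_pos _)
  have : Nonempty (Fin L) := ⟨⟨0, hLpos⟩⟩
  obtain ⟨c, d, hcd⟩ := hk₀ k hkk (Fin L) (by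
    rw [Fintype.card_fin]
    refine hL2.trans (exp_le_exp.2 ?_)
    have h1 : n * (infoNat lam ν + 2 * ρ) ≤ n * (Rc * r) := by gcongr
    have h2 : Rc * (r * n) ≤ Rc * k := by gcongr
    linarith)
  obtain ⟨w, hw⟩ := hN₁ n (le_trans (le_max_left _ _) hnN) L hL1
  rw [hav, sum_mul_sum_score hν] at hw
  set EF := ∑ m, lam m * robustPayoff uS uR (ν m) - K * ∑ m, lam m * hEnt (ν m) with hEF
  set ε' := ε / 4 / (2 * B + 1) with hε'
  have hEFB : EF ≤ B := by
    rw [hEF, ← sum_mul_sum_score hν]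
    calc ∑ m, lam m * ∑ ω, ν m ω * score uS uR K ν m ω ≤ ∑ m, lam m * ∑ ω, ν m ω * B := by
          refine sum_le_sum fun m _ => mul_le_mul_of_nonneg_left (sum_le_sum fun ω _ =>
            mul_le_mul_of_nonneg_left (le_of_abs_le (hB m ω)) ((hν m).1 ω)) (hl.1 m)
      _ = B := by simp [← sum_mul, (hν _).2, hl.2]
  -- Uncovered state sequences get the index 0, at a loss of at most `2 * B` per problem.
  have hex : ∀ ω : Fin n → Ω, ∃ i : Fin L, n * (EF - ε') -
      (if ∀ i < L, ¬ n * (EF - ε') < ∑ t, score uS uR K ν (w i t) (ω t) then n * (2 * B) else 0) ≤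
      ∑ t, score uS uR K ν (w i t) (ω t) := by
    intro ω
    by_cases h : ∀ i < L, ¬ n * (EF - ε') < ∑ t, score uS uR K ν (w i t) (ω t)
    · refine ⟨⟨0, hLpos⟩, ?_⟩
      rw [if_pos h]
      have h1 : ∑ t : Fin n, -B ≤ ∑ t, score uS uR K ν (w 0 t) (ω t) :=
        sum_le_sum fun t _ => neg_le_of_abs_le (hB _ _)
      simp only [sum_const, card_univ, Fintype.card_fin, nsmul_eq_mul] at h1
      refine le_trans ?_ h1
      have : (n : ℝ) * EF ≤ n * B := by gcongr
      have : 0 < n * ε' := by positivity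
      linarith
    · rw [if_neg h]
      push Not at h
      obtain ⟨i, hi, h⟩ := h
      exact ⟨⟨i, hi⟩, by linarith⟩
  choose f hf using hex
  set κ : (Fin n → Ω) → Fin L → ℝ := fun ω i => if f ω = i then 1 else 0 with hκd
  have hκ : ∀ ω, κ ω ∈ stdSimplex ℝ (Fin L) := fun ω =>
    ⟨fun i => by simp only [hκd]; split_ifs <;> simp, by simp [hκd]⟩
  have key := encoder_payoff_le hn hμ hQ hfull hK hlin hB hB0 hκ c d
    (e := ε') (by convert hcd) fun i => w i
  have hiid := iidLaw_mem (n := n) hμ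
  have h1 : n * (EF - ε') - n * (2 * B) * ε' ≤ ∑ i, ∑ ω, iidLaw μ ω * κ ω i *
      ∑ t, score uS uR K ν (w i t) (ω t) := by
    rw [sum_comm]
    have h2 : ∀ ω : Fin n → Ω, iidLaw μ ω * (n * (EF - ε')) - n * (2 * B) *
        (if ∀ i < L, ¬ n * (EF - ε') < ∑ t, score uS uR K ν (w i t) (ω t) then iidLaw μ ω else 0) ≤
        ∑ i : Fin L, iidLaw μ ω * κ ω i * ∑ t, score uS uR K ν (w i t) (ω t) := by
      intro ω
      have h3 := mul_le_mul_of_nonneg_left (hf ω) (hiid.1 ω)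
      simp only [hκd, mul_ite, mul_one, mul_zero, ite_mul, zero_mul, sum_ite_eq, mem_univ, if_true]
      refine le_trans (le_of_eq ?_) h3
      split_ifs <;> ring
    refine le_trans ?_ (sum_le_sum fun ω _ => h2 ω)
    rw [sum_sub_distrib, ← sum_mul, hiid.2, ← mul_sum, ← sum_filter]
    have h3 := mul_le_mul_of_nonneg_left hw (show 0 ≤ n * (2 * B) by positivity)
    refine le_trans (by linarith) (sub_le_sub_left (le_trans (le_of_eq (by congr!)) h3) _)
  -- The states and the index have joint entropy at least `n * hEnt μ`, and the index alone accounts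
  -- for at most `log L`. This bounds the average divergence from the targets without any direct
  -- estimate of the posteriors.
  have h2 : n * hEnt μ - n * (infoNat lam ν + 2 * ρ) ≤
      ∑ i, hEnt (fun ω : Fin n → Ω => iidLaw μ ω * κ ω i) := by
    have h3 := hEnt_chain fun (ω : Fin n → Ω) i => iidLaw μ ω * κ ω i
    simp only [← mul_sum, (hκ _).2, mul_one] at h3
    have h4 : 0 ≤ ∑ ω, hEnt (fun i => iidLaw μ ω * κ ω i) := sum_nonneg fun ω _ =>
      hEnt_nonneg fun i => mul_nonneg (hiid.1 ω) ((hκ ω).1 i)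
    have h5 := hEnt_le_log_card (outLaw_mem hiid hκ)
    have h6 : log (Fintype.card (Fin L)) ≤ n * (infoNat lam ν + 2 * ρ) := by
      rw [Fintype.card_fin, log_le_iff_le_exp (by exact_mod_cast hLpos)]
      exact hL2
    have h7 : hEnt (fun ω : Fin n → Ω => iidLaw μ ω) = n * hEnt μ := hEnt_iidLaw hμ
    have h8 : hEnt (fun i => ∑ ω : Fin n → Ω, iidLaw μ ω * κ ω i) = hEnt (outLaw (iidLaw μ) κ) := rfl
    linarith
  have h3 := mul_le_mul_of_nonneg_left h2 hK
  have h4 : infoNat lam ν = hEnt μ - ∑ m, lam m * hEnt (ν m) := by rw [infoNat, hav]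
  have h5 : (2 * B + 1) * ε' = ε / 4 := by rw [hε']; field_simp
  have h6 : (n : ℝ) * (∑ m, lam m * robustPayoff uS uR (ν m) - ε / 4 - (2 * B + 1) * ε' -
      2 * B * ε' - K * (2 * ρ)) ≤ n * optimalRobustPayoff uS uR μ Q n k := by
    refine le_trans (le_trans (le_of_eq ?_) (sub_le_sub_right (add_le_add h1 h3) _)) key
    rw [h4, hEF]; ring
  have h7 := le_of_mul_le_mul_left h6 hn'
  have h8 : 0 < ε' := he
  linarith

/-- Any splitting can be perturbed to have posteriors of full support, strictly less information
and almost the same payoff. -/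
theorem exists_full_support_splitting {M : ℕ} {lam : Fin M → ℝ} {ν : Fin M → Ω → ℝ}
    (hl : lam ∈ stdSimplex ℝ (Fin M)) (hν : ∀ i, ν i ∈ stdSimplex ℝ Ω)
    (hav : outLaw lam ν = μ) {ε : ℝ} (hε : 0 < ε) :
    ∃ (δ : ℝ) (ν' : Fin M → Ω → ℝ), 0 < δ ∧ δ < 1 ∧ (∀ i, ν' i ∈ stdSimplex ℝ Ω) ∧
      outLaw lam ν' = μ ∧ (∀ m ω, ν' m ω = 0 → μ ω = 0) ∧
      infoNat lam ν' ≤ (1 - δ) * infoNat lam ν ∧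
      ∑ m, lam m * robustPayoff uS uR (ν m) - ε ≤ ∑ m, lam m * robustPayoff uS uR (ν' m) := by
  have hμ : μ ∈ stdSimplex ℝ Ω := hav ▸ outLaw_mem hl hν
  have h1 : ∀ m, Tendsto (fun δ : ℝ => fun ω => (1 - δ) * ν m ω + δ * μ ω) (𝓝[>] 0) (𝓝 (ν m)) := by
    intro m
    have : Continuous (fun δ : ℝ => fun ω => (1 - δ) * ν m ω + δ * μ ω) := by fun_prop
    refine ((this.tendsto 0).mono_left nhdsWithin_le_nhds).trans (by simp)
  have h2 := eventually_all.2 fun m =>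
    (h1 m).eventually (robustPayoff_lowerSemicontinuous uS uR (ν m) hε)
  have h3 : ∀ᶠ δ : ℝ in 𝓝[>] 0, δ ∈ Set.Ioo (0 : ℝ) 1 := Ioo_mem_nhdsGT one_pos
  obtain ⟨δ, h2, hδ0, hδ1⟩ := (h2.and h3).exists
  -- Moving posteriors towards the prior preserves their average, charges the support of `μ`, and by
  -- concavity scales the information by at most `1 - δ`; semicontinuity protects the payoff for
  -- small `δ`.
  set ν' : Fin M → Ω → ℝ := fun m ω => (1 - δ) * ν m ω + δ * μ ω with hν'
  have hav' : outLaw lam ν' = μ := by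
    funext ω
    have h4 : ∑ m, lam m * ν m ω = μ ω := congrFun hav ω
    simp only [outLaw, hν', mul_add, sum_add_distrib, ← sum_mul, hl.2, mul_left_comm _ (1 - δ),
      ← mul_sum, h4]
    ring
  refine ⟨δ, ν', hδ0, hδ1, fun m => ⟨fun ω => ?_, ?_⟩, hav', fun m ω h => ?_, ?_, ?_⟩
  · exact add_nonneg (mul_nonneg (by linarith) ((hν m).1 ω)) (mul_nonneg hδ0.le (hμ.1 ω))
  · simp only [hν', sum_add_distrib, ← mul_sum, (hν m).2, hμ.2]; ring
  · have h4 : 0 ≤ (1 - δ) * ν m ω := mul_nonneg (by linarith) ((hν m).1 ω)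
    have h5 := hμ.1 ω
    simp only [hν'] at h
    nlinarith
  · have h4 : ∀ m, (1 - δ) * hEnt (ν m) + δ * hEnt μ ≤ hEnt (ν' m) := by
      intro m
      have := sum_hEnt_le (fun b : Bool => fun ω => if b then (1 - δ) * ν m ω else δ * μ ω) (by
        rintro (_ | _) ω
        · simpa using mul_nonneg hδ0.le (hμ.1 ω)
        · simpa using mul_nonneg (by linarith) ((hν m).1 ω))
      simpa [hEnt_smul (hν m).1, hEnt_smul hμ.1] using this
    have h5 := sum_le_sum fun m (_ : m ∈ univ) => mul_le_mul_of_nonneg_left (h4 m) (hl.1 m)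
    simp only [mul_add, sum_add_distrib, ← sum_mul, hl.2, mul_left_comm _ (1 - δ),
      ← mul_sum] at h5
    rw [infoNat, infoNat, hav, hav']
    linarith
  · have h4 := sum_le_sum fun m (_ : m ∈ univ) => mul_le_mul_of_nonneg_left (h2 m) (hl.1 m)
    simp only [mul_sub, sum_sub_distrib, ← sum_mul, hl.2] at h4
    linarith

end Achievability

/-! ### Limits in the three regimes of `r` -/

section Limits

variable {Ω A X Y : Type*} [Fintype Ω] [Fintype A] [Nonempty A] [Fintype X] [Nonempty X]
  [Fintype Y] {uS uR : Ω → A → ℝ} {μ : Ω → ℝ} {Q : X → Y → ℝ}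

/-- Nearly optimal splittings with posteriors of full support and strictly slack information. -/
theorem exists_near_optimal_splitting (hμ : μ ∈ stdSimplex ℝ Ω) {c : EReal} (hc : 0 ≤ c) {ε : ℝ}
    (hε : 0 < ε) :
    ∃ (M : ℕ) (lam : Fin M → ℝ) (ν : Fin M → Ω → ℝ) (δ i : ℝ), lam ∈ stdSimplex ℝ (Fin M) ∧
      (∀ m, ν m ∈ stdSimplex ℝ Ω) ∧ outLaw lam ν = μ ∧ (∀ m ω, ν m ω = 0 → μ ω = 0) ∧
      0 < δ ∧ δ < 1 ∧ infoNat lam ν ≤ (1 - δ) * i ∧ ((i / log 2 : ℝ) : EReal) ≤ c ∧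
      splittingValue uS uR μ c - ε ≤ ∑ m, lam m * robustPayoff uS uR (ν m) := by
  have h1 : ∃ (M : ℕ) (lam : Fin M → ℝ) (ν : Fin M → Ω → ℝ), lam ∈ stdSimplex ℝ (Fin M) ∧
      (∀ m, ν m ∈ stdSimplex ℝ Ω) ∧ outLaw lam ν = μ ∧
      ((infoNat lam ν / log 2 : ℝ) : EReal) ≤ c ∧
      splittingValue uS uR μ c - ε / 2 < ∑ m, lam m * robustPayoff uS uR (ν m) := by
    by_contra! h
    have := splittingValue_le (uS := uS) (uR := uR) hμ hc h
    linarith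
  obtain ⟨M, lam, ν, hl, hν, hav, hi, hv⟩ := h1
  obtain ⟨δ, ν', hδ0, hδ1, hν', hav', hfull, hi', hv'⟩ :=
    exists_full_support_splitting (uS := uS) (uR := uR) hl hν hav (half_pos hε)
  -- `i` is the information of the unperturbed splitting, so the slack is the factor `1 - δ`.
  exact ⟨M, lam, ν', δ, infoNat lam ν, hl, hν', hav', hfull, hδ0, hδ1, hi', hi, by linarith⟩

/-- The slack `1 - δ` in the information pays for replacing `r` by `(1 - δ/2) * r`, a ratio that `k
/ n` eventually exceeds. -/
theorem eventually_le_optimalRobustPayoff (hμ : μ ∈ stdSimplex ℝ Ω)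
    (hQ : ∀ x, Q x ∈ stdSimplex ℝ Y) (hC : 0 < capacity Q) {r : ℝ} (hr : 0 < r) {n k : ℕ → ℕ}
    (hn : ∀ j, 0 < n j) (hn' : Tendsto n atTop atTop)
    (hk : Tendsto (fun j => (k j : ℝ) / n j) atTop (𝓝 r)) {ε : ℝ} (hε : 0 < ε) :
    ∀ᶠ j in atTop, splittingValue uS uR μ ((r * capacity Q : ℝ) : EReal) - ε ≤
      optimalRobustPayoff uS uR μ Q (n j) (k j) := by
  have hlog := log_pos one_lt_two
  obtain ⟨M, lam, ν, δ, i, hl, hν, hav, hfull, hδ0, hδ1, hi, hic, hv⟩ :=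
    exists_near_optimal_splitting (uS := uS) (uR := uR) hμ (c := ((r * capacity Q : ℝ) : EReal))
      (by exact_mod_cast (by positivity)) (half_pos hε)
  have hic' : i / log 2 ≤ r * capacity Q := by exact_mod_cast hic
  rw [div_le_iff₀ hlog] at hic'
  have hlt : infoNat lam ν < (1 - δ / 2) * r * (capacity Q * log 2) := by
    have h1 : 0 < r * (capacity Q * log 2) := by positivity
    have h2 : (1 - δ) * i ≤ (1 - δ) * (r * capacity Q * log 2) :=
      mul_le_mul_of_nonneg_left hic' (by linarith)
    nlinarith
  obtain ⟨N, hN⟩ := exists_forall_le_optimalRobustPayoff (uS := uS) (uR := uR) hl hν hav hfull hQ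
    (show 0 < (1 - δ / 2) * r from mul_pos (by linarith) hr) hlt (half_pos hε)
  filter_upwards [hn'.eventually_ge_atTop N, hk.eventually_const_le
    (show (1 - δ / 2) * r < r by nlinarith)] with j h1 h2
  have h3 : (0 : ℝ) < n j := by exact_mod_cast hn j
  rw [le_div_iff₀ h3] at h2
  have := hN (n j) h1 (hn j) (k j) h2
  linarith

/-- The threshold is uniform in `n` because `n` need not tend to infinity when `k / n` does. Large
`n` use block coding at a fixed ratio; the finitely many others each use the result for fixed `n`.
-/
theorem exists_ratio_le_optimalRobustPayoff (hμ : μ ∈ stdSimplex ℝ Ω)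
    (hQ : ∀ x, Q x ∈ stdSimplex ℝ Y) (hC : 0 < capacity Q) {ε : ℝ} (hε : 0 < ε) :
    ∃ R : ℝ, ∀ n k : ℕ, 0 < n → R * n ≤ k → splittingValue uS uR μ ⊤ - ε ≤
      optimalRobustPayoff uS uR μ Q n k := by
  have hlog := log_pos one_lt_two
  obtain ⟨M, lam, ν, δ, i, hl, hν, hav, hfull, hδ0, hδ1, hi, hic, hv⟩ :=
    exists_near_optimal_splitting (uS := uS) (uR := uR) hμ (c := ⊤) le_top (half_pos hε)
  have hi0 := infoNat_nonneg hl hν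
  set r := (infoNat lam ν + 1) / (capacity Q * log 2) with hr
  have hr0 : 0 < r := by positivity
  have hlt : infoNat lam ν < r * (capacity Q * log 2) := by
    rw [hr, div_mul_cancel₀ _ (by positivity)]; linarith
  obtain ⟨N, hN⟩ := exists_forall_le_optimalRobustPayoff (uS := uS) (uR := uR) hl hν hav hfull hQ
    hr0 hlt (half_pos hε)
  have h1 : ∀ n : ℕ, ∃ k₀ : ℕ, 0 < n → ∀ k ≥ k₀, ∑ m, lam m * robustPayoff uS uR (ν m) - ε / 2 ≤
      optimalRobustPayoff uS uR μ Q n k := by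
    intro n
    by_cases hn : 0 < n
    · obtain ⟨k₀, hk₀⟩ := exists_forall_le_optimalRobustPayoff_of_fixed (uS := uS) (uR := uR)
        hl hν hav hfull hQ hC (half_pos hε) hn
      exact ⟨k₀, fun _ => hk₀⟩
    · exact ⟨0, fun h => absurd h hn⟩
  choose k₀ hk₀ using h1
  refine ⟨max r (((range N).sup k₀ : ℕ) : ℝ), fun n k hn hk => ?_⟩
  have hn' : (1 : ℝ) ≤ n := by exact_mod_cast hn
  by_cases hnN : N ≤ n
  · have h2 : r * n ≤ max r (((range N).sup k₀ : ℕ) : ℝ) * n := by gcongr; exact le_max_left _ _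
    have := hN n hnN hn k (h2.trans hk)
    linarith
  · have h2 : k₀ n ≤ (range N).sup k₀ := le_sup (f := k₀) (mem_range.2 (not_le.1 hnN))
    have h3 : (((range N).sup k₀ : ℕ) : ℝ) ≤ k := by
      refine le_trans ?_ hk
      calc (((range N).sup k₀ : ℕ) : ℝ) ≤ ((range N).sup k₀ : ℕ) * n :=
            le_mul_of_one_le_right (by positivity) hn'
        _ ≤ _ := by gcongr; exact le_max_right _ _
    have := hk₀ n hn k (h2.trans (by exact_mod_cast h3))
    linarith

/-- Continuity of the value at zero capacity. -/
theorem splittingValue_le_add_mul (hμ : μ ∈ stdSimplex ℝ Ω)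
    (hcont : ContinuousWithinAt (robustPayoff uS uR)
      {ν | ν ∈ stdSimplex ℝ Ω ∧ ∀ ω, μ ω = 0 → ν ω = 0} μ) {ε : ℝ} (hε : 0 < ε) :
    ∃ K : ℝ, 0 ≤ K ∧ ∀ c : ℝ, 0 ≤ c →
      splittingValue uS uR μ (c : EReal) ≤ robustPayoff uS uR μ + ε + K * c := by
  obtain ⟨B, -, hB⟩ := exists_abs_le uS
  have hB' : ∀ q ∈ stdSimplex ℝ Ω, |-robustPayoff uS uR q| ≤ B := fun q hq => by
    simpa [hq.2] using abs_robustPayoff_le uS uR hB hq.1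
  -- Applied to minus the robust payoff, this turns upper semicontinuity at the prior into an upper
  -- bound. The divergences from the prior then average to the information.
  obtain ⟨K, hK, h⟩ := exists_sub_mul_divergence_le hB' hμ hε.le
    ((hcont.eventually_le_const (show robustPayoff uS uR μ < robustPayoff uS uR μ + ε by
      linarith)).mono fun q hq => by linarith)
  have hlog := log_pos one_lt_two
  refine ⟨K * log 2, by positivity, fun c hc => ?_⟩
  refine splittingValue_le hμ (by exact_mod_cast hc) fun M lam ν hl hν hav hi => ?_
  have hi' : infoNat lam ν / log 2 ≤ c := by exact_mod_cast hi
  rw [div_le_iff₀ hlog, infoNat_eq_sum_divergence hav hμ] at hi'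
  have h1 : ∀ m, lam m * robustPayoff uS uR (ν m) ≤ lam m * (robustPayoff uS uR μ + ε) +
      K * (lam m * (crossEnt (ν m) μ - hEnt (ν m))) := by
    intro m
    rcases (hl.1 m).eq_or_lt with h0 | h0
    · simp [← h0]
    · have h2 := h (ν m) (hν m) fun ω hω =>
        posterior_eq_zero hl.1 (fun i => (hν i).1) hav h0 hω
      have h3 := mul_le_mul_of_nonneg_left h2 h0.le
      linarith
  refine (sum_le_sum fun m _ => h1 m).trans ?_
  rw [sum_add_distrib, ← sum_mul, hl.2, ← mul_sum]
  have := mul_le_mul_of_nonneg_left hi' hK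
  linarith

/-- With a finite limit ratio, a bounded `n j` would keep `k j` bounded as well. -/
theorem tendsto_atTop_of_ratio {r : ℝ} {n k : ℕ → ℕ} (hn : ∀ j, 0 < n j)
    (hmax : Tendsto (fun j => max (n j) (k j)) atTop atTop)
    (hk : Tendsto (fun j => (k j : ℝ) / n j) atTop (𝓝 r)) : Tendsto n atTop atTop := by
  refine tendsto_atTop.2 fun N => ?_
  obtain ⟨T, hT⟩ := exists_nat_gt ((|r| + 1) * N)
  filter_upwards [hmax.eventually_ge_atTop (max T N), hk.eventually_le_const
    (show r < |r| + 1 by linarith [le_abs_self r])] with j h1 h2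
  by_contra! h
  have h3 : (0 : ℝ) < n j := by exact_mod_cast hn j
  rw [div_le_iff₀ h3] at h2
  have h4 : (n j : ℝ) ≤ N := by exact_mod_cast h.le
  have h5 : (k j : ℝ) < T := by
    have : (|r| + 1) * n j ≤ (|r| + 1) * N := by gcongr
    linarith
  have h6 : k j < T := by exact_mod_cast h5
  omega

theorem tendsto_optimalRobustPayoff_of_pos (hμ : μ ∈ stdSimplex ℝ Ω)
    (hQ : ∀ x, Q x ∈ stdSimplex ℝ Y) (hC : 0 < capacity Q) {r : ℝ} (hr : 0 < r) {n k : ℕ → ℕ}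
    (hn : ∀ j, 0 < n j) (hn' : Tendsto n atTop atTop)
    (hk : Tendsto (fun j => (k j : ℝ) / n j) atTop (𝓝 r)) :
    Tendsto (fun j => optimalRobustPayoff uS uR μ Q (n j) (k j)) atTop
      (𝓝 (splittingValue uS uR μ ((r * capacity Q : ℝ) : EReal))) := by
  set V := splittingValue uS uR μ ((r * capacity Q : ℝ) : EReal) with hV
  refine tendsto_order.2 ⟨fun a ha => ?_, fun a ha => ?_⟩
  · filter_upwards [eventually_le_optimalRobustPayoff (uS := uS) (uR := uR) hμ hQ hC hr hn hn' hk
      (show 0 < (V - a) / 2 by linarith)] with j hj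
    linarith
  · obtain ⟨B, -, hB⟩ := exists_abs_le uS
    -- Right continuity of the value: `k / n` may exceed `r` slightly, so the upper bound is taken
    -- at `s * r` with `s` close to 1.
    have h1 : Tendsto (fun s : ℝ => s * V + (s - 1) * B) (𝓝[>] 1) (𝓝 V) := by
      have : Continuous fun s : ℝ => s * V + (s - 1) * B := by fun_prop
      exact ((this.tendsto 1).mono_left nhdsWithin_le_nhds).trans (by simp)
    obtain ⟨s, hs, hs1⟩ := ((h1.eventually_lt_const ha).and self_mem_nhdsWithin).exists
    have hs1 : 1 < s := hs1
    filter_upwards [hk.eventually_le_const (show r < s * r by nlinarith)] with j hj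
    refine lt_of_le_of_lt ?_ hs
    refine (optimalRobustPayoff_le (hn j) hμ hQ).trans (le_trans ?_
      (splittingValue_mul_le hμ hB (by positivity) hs1.le))
    refine splittingValue_mono hμ (by exact_mod_cast (by positivity)) ?_
    norm_cast
    rw [← mul_assoc]
    gcongr

theorem tendsto_optimalRobustPayoff_of_zero (hμ : μ ∈ stdSimplex ℝ Ω)
    (hQ : ∀ x, Q x ∈ stdSimplex ℝ Y)
    (hcont : ContinuousWithinAt (robustPayoff uS uR)
      {ν | ν ∈ stdSimplex ℝ Ω ∧ ∀ ω, μ ω = 0 → ν ω = 0} μ) {n k : ℕ → ℕ}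
    (hn : ∀ j, 0 < n j) (hk : Tendsto (fun j => (k j : ℝ) / n j) atTop (𝓝 0)) :
    Tendsto (fun j => optimalRobustPayoff uS uR μ Q (n j) (k j)) atTop
      (𝓝 (robustPayoff uS uR μ)) := by
  refine tendsto_order.2 ⟨fun a ha => Eventually.of_forall fun j =>
    ha.trans_le (robustPayoff_le_optimalRobustPayoff (hn j) hμ hQ), fun a ha => ?_⟩
  obtain ⟨K, -, h⟩ := splittingValue_le_add_mul hμ hcont (half_pos (sub_pos.2 ha))
  have h1 : Tendsto (fun j => robustPayoff uS uR μ + (a - robustPayoff uS uR μ) / 2 +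
      K * ((k j : ℝ) / n j * capacity Q)) atTop (𝓝 (robustPayoff uS uR μ +
      (a - robustPayoff uS uR μ) / 2 + K * (0 * capacity Q))) :=
    ((hk.mul_const _).const_mul _).const_add _
  have h0 := capacity_nonneg hQ
  filter_upwards [h1.eventually_lt_const (show _ < a by linarith)] with j hj
  exact ((optimalRobustPayoff_le (hn j) hμ hQ).trans (h _ (by positivity))).trans_lt hj

theorem tendsto_optimalRobustPayoff_of_top (hμ : μ ∈ stdSimplex ℝ Ω)
    (hQ : ∀ x, Q x ∈ stdSimplex ℝ Y) (hC : 0 < capacity Q) {n k : ℕ → ℕ}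
    (hn : ∀ j, 0 < n j) (hk : Tendsto (fun j => (k j : ℝ) / n j) atTop atTop) :
    Tendsto (fun j => optimalRobustPayoff uS uR μ Q (n j) (k j)) atTop
      (𝓝 (splittingValue uS uR μ ⊤)) := by
  refine tendsto_order.2 ⟨fun a ha => ?_, fun a ha => Eventually.of_forall fun j => ?_⟩
  · obtain ⟨R, hR⟩ := exists_ratio_le_optimalRobustPayoff (uS := uS) (uR := uR) hμ hQ hC
      (half_pos (sub_pos.2 ha))
    filter_upwards [hk.eventually_ge_atTop R] with j hj
    rw [le_div_iff₀ (by exact_mod_cast hn j)] at hj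
    have := hR (n j) (k j) (hn j) hj
    linarith
  · refine lt_of_le_of_lt ((optimalRobustPayoff_le (hn j) hμ hQ).trans
      (splittingValue_mono hμ ?_ le_top)) ha
    exact_mod_cast (by positivity)

theorem optimalRobustPayoff_eq_of_capacity_eq_zero (hμ : μ ∈ stdSimplex ℝ Ω)
    (hQ : ∀ x, Q x ∈ stdSimplex ℝ Y) (hC : capacity Q = 0) {n k : ℕ} (hn : 0 < n) :
    optimalRobustPayoff uS uR μ Q n k = robustPayoff uS uR μ := by
  refine le_antisymm ?_ (robustPayoff_le_optimalRobustPayoff hn hμ hQ)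
  have := optimalRobustPayoff_le (uS := uS) (uR := uR) (k := k) hn hμ hQ
  rwa [hC, mul_zero, EReal.coe_zero, splittingValue_zero hμ] at this

end Limits

end

end Persuasion

open Persuasion Filter Topology in
theorem theorem1 {Ω A X Y : Type*} [Fintype Ω] [Fintype A] [Nonempty A]
    [Fintype X] [Nonempty X] [Fintype Y]
    (uS uR : Ω → A → ℝ) (μ : Ω → ℝ) (hμ : μ ∈ stdSimplex ℝ Ω)
    (Q : X → Y → ℝ) (hQ : ∀ x, Q x ∈ stdSimplex ℝ Y) :
    (∀ n k : ℕ, 0 < n →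
      optimalRobustPayoff uS uR μ Q n k ≤
        splittingValue uS uR μ (((k : ℝ) / (n : ℝ) * capacity Q : ℝ) : EReal)) ∧
    (∀ (r : ENNReal) (n k : ℕ → ℕ),
      (r = 0 → capacity Q ≠ 0 →
        ContinuousWithinAt (robustPayoff uS uR)
          {ν | ν ∈ stdSimplex ℝ Ω ∧ ∀ ω, μ ω = 0 → ν ω = 0} μ) →
      (∀ j, 0 < n j) →
      Tendsto (fun j => max (n j) (k j)) atTop atTop →
      Tendsto (fun j => (k j : ENNReal) / (n j : ENNReal)) atTop (𝓝 r) →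
      Tendsto (fun j => optimalRobustPayoff uS uR μ Q (n j) (k j)) atTop
        (𝓝 (splittingValue uS uR μ ((r : EReal) * (capacity Q : EReal))))) := by
  refine ⟨fun n k hn => optimalRobustPayoff_le hn hμ hQ, fun r n k hcont hn hmax hk => ?_⟩
  -- With zero capacity the payoff does not depend on `n` and `k`, which settles every `r`,
  -- including `⊤ * 0 = 0`.
  by_cases hC : capacity Q = 0
  · simp only [optimalRobustPayoff_eq_of_capacity_eq_zero hμ hQ hC (hn _), hC, EReal.coe_zero,
      mul_zero, splittingValue_zero hμ, tendsto_const_nhds]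
  have hC0 : 0 < capacity Q := lt_of_le_of_ne (capacity_nonneg hQ) (Ne.symm hC)
  have hne : ∀ j, (k j : ENNReal) / (n j : ENNReal) ≠ ⊤ := fun j =>
    ENNReal.div_ne_top (ENNReal.natCast_ne_top _) (by exact_mod_cast (hn j).ne')
  by_cases hr : r = ⊤
  · subst hr
    rw [EReal.coe_ennreal_top, EReal.top_mul_coe_of_pos hC0]
    refine tendsto_optimalRobustPayoff_of_top hμ hQ hC0 hn ?_
    refine tendsto_atTop.2 fun R => ?_
    filter_upwards [hk.eventually_const_le (ENNReal.ofReal_lt_top (r := R))] with j hj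
    have := (ENNReal.ofReal_le_iff_le_toReal (hne j)).1 hj
    simpa using this
  have hk' : Tendsto (fun j => (k j : ℝ) / n j) atTop (𝓝 r.toReal) := by
    simpa [Function.comp_def] using (ENNReal.tendsto_toReal hr).comp hk
  have hcoe : (r : EReal) * (capacity Q : EReal) = ((r.toReal * capacity Q : ℝ) : EReal) := by
    rw [EReal.coe_mul, EReal.coe_ennreal_toReal hr]
  rw [hcoe]
  by_cases hr0 : r = 0
  · subst hr0
    simp only [ENNReal.toReal_zero, zero_mul, EReal.coe_zero, splittingValue_zero hμ] at hk' ⊢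
    exact tendsto_optimalRobustPayoff_of_zero hμ hQ (hcont rfl hC) hn hk'
  · exact tendsto_optimalRobustPayoff_of_pos hμ hQ hC0 (ENNReal.toReal_pos hr0 hr) hn
      (tendsto_atTop_of_ratio hn hmax hk') hk'
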